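/- Let $\bar X$ be a complex projective surface, all of whose points are at worst abelian quotient singularities: for every $p\in\bar X$ there is an isomorphism of analytic germs $(\bar X,p)\cong(\mathbb{C}^2/A,0)$ with $A\subset \mathrm{GL}(2;\mathbb{C})$ a finite abelian group that is small (it contains no pseudo-reflections). Put $\iota_p:=|A|$. Let $\mathcal{D}=\bigcup_{j=1}^r D_j\subset\bar X$ be a hypersurface with irreducible components $D_1,\dots,D_r$, and let $\varphi$ assign to each $D_j$ an integer $n_j:=\varphi(D_j)\ge 0$. Assume that the orbifold $(\bar X,\varphi)$ is normal crossing with smooth components, that is, every $p\in\bar X$ has an isomorphism $(\bar X,p)\cong(\mathbb{C}^2/A,0)$ as above for which the components $D_j$ through $p$ are the images of pairwise different coordinate axes of $\mathbb{C}^2$, each having its axis as full preimage (in particular at most two components pass through $p$). Put $X_\varphi^+:=\bar X\setminus\bigcup_{n_j=0}D_j$ and $\mathring X_\varphi:=\bar X\setminus\mathcal{D}$, and let $$\nu(p):=\begin{cases}\iota_p & \text{if } p\notin\mathcal{D},\\ n_j\,\iota_p & \text{if } D_j \text{ is the only component through } p,\\ n_i n_j\,\iota_p & \text{if } p\in D_i\cap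 D_j,\ i\ne j.\end{cases}$$ Let $\mathbb{B}_p$ be a small ball around $p$, i.e. the image of a ball around $0$, preserved by $A$, under such an adapted isomorphism that is defined on it. The local orbifold fundamental group $\pi_1^{\mathrm{orb}}(\bar X,\varphi)_p$ is the quotient of $\pi_1(\mathrm{Reg}(\mathring X_\varphi)\cap\mathbb{B}_p)$ by the subgroup normally generated by the powers $\mu_j^{n_j}$ of the meridians $\mu_j$ of the components $D_j$ in $\mathbb{B}_p$. Then for every $p\in X_\varphi^+$ (and every such ball and base point) the group $\pi_1^{\mathrm{orb}}(\bar X,\varphi)_p$ is finite and $$\#\pi_1^{\mathrm{orb}}(\bar X,\varphi)_p=\nu(p).$$ -/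

import Mathlib

open scoped LinearAlgebra.Projectivization

noncomputable section

namespace OrbifoldSurface

/-! ### Complex projective space: Euclidean topology, algebraic subsets, holomorphic maps -/

/-- Homogeneous coordinate vectors of `ℙ^N`. -/
abbrev Vec (N : ℕ) : Type := Fin (N + 1) → ℂ

/-- The complex projective space `ℙ^N`. -/
abbrev CP (N : ℕ) : Type := ℙ ℂ (Vec N)

/-- The Euclidean topology of `ℙ^N`: the quotient topology from `ℂ^(N+1) ∖ {0}`. -/
instance instTopologicalSpaceCP (N : ℕ) : TopologicalSpace (CP N) :=
  TopologicalSpace.coinduced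
    (fun v : {v : Vec N // v ≠ 0} => Projectivization.mk ℂ (v : Vec N) v.2) inferInstance

/-- Zariski closed subsets of `ℙ^N`: common zeros of homogeneous polynomials. -/
def IsAlgebraic {N : ℕ} (Z : Set (CP N)) : Prop :=
  ∃ S : Set (MvPolynomial (Fin (N + 1)) ℂ),
    (∀ f ∈ S, ∃ d : ℕ, f.IsHomogeneous d) ∧
      Z = {q | ∀ f ∈ S, MvPolynomial.eval q.rep f = 0}

/-- Irreducible Zariski closed subsets of `ℙ^N` (projective varieties). -/
def IsProjectiveVariety {N : ℕ} (Z : Set (CP N)) : Prop :=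
  IsAlgebraic Z ∧ Z.Nonempty ∧
    ∀ Z₁ Z₂ : Set (CP N), IsAlgebraic Z₁ → IsAlgebraic Z₂ → Z ⊆ Z₁ ∪ Z₂ → Z ⊆ Z₁ ∨ Z ⊆ Z₂

/-- `ℂ²` with its Hermitian norm. -/
abbrev C2 : Type := EuclideanSpace ℂ (Fin 2)

/-- A map from `ℂ²` to `ℙ^N` is holomorphic at `z` if near `z` it is given by holomorphic
homogeneous coordinates without common zero. -/
def HolomorphicMapAt {N : ℕ} (f : C2 → CP N) (z : C2) : Prop :=
  ∃ F : C2 → Vec N, AnalyticAt ℂ F z ∧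
    ∀ᶠ w in nhds z, ∃ h : F w ≠ 0, f w = Projectivization.mk ℂ (F w) h

open Classical in
/-- A function on `ℙ^N` is holomorphic at `q` if its pull-back to the space of homogeneous
coordinates is holomorphic at every representative of `q`. -/
def HolomorphicFunctionAt {N : ℕ} (G : CP N → ℂ) (q : CP N) : Prop :=
  ∀ (v : Vec N) (hv : v ≠ 0), Projectivization.mk ℂ v hv = q →
    AnalyticAt ℂ (fun w : Vec N => if h : w ≠ 0 then G (Projectivization.mk ℂ w h) else 0) v

/-! ### Abelian quotient singularities -/

/-- The linear action of `GL(2, ℂ)` on `ℂ²`. -/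
def act (a : Matrix.GeneralLinearGroup (Fin 2) ℂ) (z : C2) : C2 :=
  WithLp.toLp 2 (Matrix.mulVec (a : Matrix (Fin 2) (Fin 2) ℂ) z.ofLp)

/-- An isomorphism `(S, p) ≅ (ℂ²/A, 0)` with `A ⊂ GL(2, ℂ)` a small finite abelian group,
for a locally Zariski closed set `S ⊆ ℙ^N` with its reduced analytic structure. It is given by
the composition of the quotient map with the isomorphism, on a ball `𝔹₀` around `0` that is
preserved by `A`: a holomorphic map `𝔹₀ → S` whose fibres are the `A`-orbits, which is open onto
its image, and for which the holomorphic functions on `S` are the `A`-invariant holomorphic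
functions upstairs. Values of `toFun` outside the ball are irrelevant. -/
structure QuotientChart {N : ℕ} (S : Set (CP N)) (p : CP N) where
  /-- the group `A` -/
  A : Subgroup (Matrix.GeneralLinearGroup (Fin 2) ℂ)
  finite_A : Finite A
  comm_A : ∀ a ∈ A, ∀ b ∈ A, a * b = b * a
  /-- `A` is small: it contains no pseudo-reflections. -/
  small_A : ∀ a ∈ A, ((a : Matrix (Fin 2) (Fin 2) ℂ) - 1).rank ≠ 1
  /-- the radius of `𝔹₀` -/
  radius : ℝ
  radius_pos : 0 < radius
  ball_invariant : ∀ a ∈ A, ∀ z ∈ Metric.ball (0 : C2) radius,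
    act a z ∈ Metric.ball (0 : C2) radius
  toFun : C2 → CP N
  map_zero : toFun 0 = p
  map_mem : ∀ z ∈ Metric.ball (0 : C2) radius, toFun z ∈ S
  holomorphic : ∀ z ∈ Metric.ball (0 : C2) radius, HolomorphicMapAt toFun z
  fibres : ∀ z ∈ Metric.ball (0 : C2) radius, ∀ w ∈ Metric.ball (0 : C2) radius,
    toFun z = toFun w ↔ ∃ a ∈ A, w = act a z
  open_map : ∀ O : Set C2, IsOpen O → O ⊆ Metric.ball (0 : C2) radius →
    ∃ W : Set (CP N), IsOpen W ∧ toFun '' O = W ∩ S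
  functions : ∀ O : Set C2, IsOpen O → O ⊆ Metric.ball (0 : C2) radius →
    (∀ a ∈ A, ∀ z ∈ O, act a z ∈ O) →
    ∀ g : C2 → ℂ, AnalyticOnNhd ℂ g O → (∀ a ∈ A, ∀ z ∈ O, g (act a z) = g z) →
    ∀ z ∈ O, ∃ G : CP N → ℂ, HolomorphicFunctionAt G (toFun z) ∧
      ∀ᶠ w in nhds z, g w = G (toFun w)

/-- `Reg(S)`: the points at which `S` is a complex surface without singularities, i.e. at which
`S` has a holomorphic chart (the group `A` is trivial). -/
def regularLocus {N : ℕ} (S : Set (CP N)) : Set (CP N) :=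
  {q | q ∈ S ∧ ∃ e : QuotientChart S q, e.A = ⊥}

open Classical in
/-- `ι_p = |A|` if `(S, p) ≅ (ℂ²/A, 0)` with `A` small abelian. -/
def quotientOrder {N : ℕ} (S : Set (CP N)) (p : CP N) : ℕ :=
  if h : Nonempty (QuotientChart S p) then Nat.card h.some.A else 0

/-! ### Orbifolds -/

/-- An orbifold `(X̄, φ)` of dimension two: a projective variety `X̄ ⊆ ℙ^N` all of whose points
are at worst abelian quotient singularities of surfaces (so `X̄` is a normal surface), a
hypersurface `𝓓` with irreducible components `D₁, …, D_r`, and numbers `nᵢ = φ(Dᵢ) ≥ 0`.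
An irreducible closed subset of the irreducible surface `X̄` has codimension one if and only if
it is a proper subset with more than one point. -/
structure Orbifold (N : ℕ) where
  X : Set (CP N)
  variety_X : IsProjectiveVariety X
  quotient_singularities : ∀ p ∈ X, Nonempty (QuotientChart X p)
  /-- the number of components of `𝓓` -/
  r : ℕ
  D : Fin r → Set (CP N)
  D_injective : Function.Injective D
  variety_D : ∀ i, IsProjectiveVariety (D i)
  D_ssubset : ∀ i, D i ⊂ X
  D_nontrivial : ∀ i, (D i).Nontrivial
  φ : Fin r → ℕ

namespace Orbifold

variable {N : ℕ} (O : Orbifold N)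

/-- The hypersurface `𝓓 = ⋃ Dᵢ`. -/
def divisor : Set (CP N) := ⋃ i, O.D i

/-- The positive part `X_φ⁺ = X̄ ∖ φ⁻¹(0)`. -/
def positivePart : Set (CP N) := O.X \ ⋃ i ∈ {i | O.φ i = 0}, O.D i

/-- The chart `(X̄, p) ≅ (ℂ²/A, 0)` is adapted to `𝓓`: over the image of the ball, the components
of `𝓓` that meet the image pass through `p`, and they are the images of different coordinate
axes of `ℂ²` (so there are at most two of them). -/
def IsAdapted {p : CP N} (c : QuotientChart O.X p) : Prop :=
  ∃ k : Fin O.r → Fin 2, Set.InjOn k {i | p ∈ O.D i} ∧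
    ∀ i, ∀ z ∈ Metric.ball (0 : C2) c.radius,
      c.toFun z ∈ O.D i ↔ p ∈ O.D i ∧ z (k i) = 0

/-- `(X̄, φ)` is a normal-crossing orbifold: `𝓓` is a normal crossing divisor with smooth
components. As usual on varieties with quotient singularities, this is a condition on the
pull-back of `𝓓` to the local uniformizations. -/
def IsNormalCrossing : Prop :=
  ∀ p ∈ O.X, ∃ c : QuotientChart O.X p, O.IsAdapted c

open Classical in
/-- The orbifold index `ν(p)`: the product of `ι_p` and of the `n_j` of the components `D_j` that
pass through `p`. -/
def orbifoldIndex (p : CP N) : ℕ :=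
  (∏ j ∈ Finset.univ.filter (fun j => p ∈ O.D j), O.φ j) * quotientOrder O.X p

theorem orbifoldIndex_of_notMem {p : CP N} (hp : p ∉ O.divisor) :
    O.orbifoldIndex p = quotientOrder O.X p := by
  have h : ∀ j, p ∉ O.D j := fun j hj => hp (Set.mem_iUnion.2 ⟨j, hj⟩)
  simp [orbifoldIndex, h]

theorem orbifoldIndex_of_mem_one {p : CP N} {j : Fin O.r}
    (hj : ∀ i, p ∈ O.D i ↔ i = j) :
    O.orbifoldIndex p = O.φ j * quotientOrder O.X p := by
  simp [orbifoldIndex, hj, Finset.filter_eq']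

theorem orbifoldIndex_of_mem_two {p : CP N} {i j : Fin O.r} (hij : i ≠ j)
    (h : ∀ l, p ∈ O.D l ↔ l = i ∨ l = j) :
    O.orbifoldIndex p = O.φ i * O.φ j * quotientOrder O.X p := by
  classical
  have hf : Finset.univ.filter (fun l => p ∈ O.D l) = {i, j} := by
    ext l
    simp [h]
  unfold orbifoldIndex
  rw [← Finset.prod_pair hij, ← hf]

/-! ### Local orbifold fundamental groups -/

/-- `U` is a small ball `𝔹_p` around `p`: the image of a ball around `0` in an adapted
chart. -/
def IsSmallBall (p : CP N) (U : Set (CP N)) : Prop :=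
  ∃ c : QuotientChart O.X p, O.IsAdapted c ∧
    ∃ ρ : ℝ, 0 < ρ ∧ ρ ≤ c.radius ∧ U = c.toFun '' Metric.ball (0 : C2) ρ

theorem exists_isSmallBall (hO : O.IsNormalCrossing) {p : CP N} (hp : p ∈ O.X) :
    ∃ U, O.IsSmallBall p U :=
  let ⟨c, hc⟩ := hO p hp
  ⟨_, c, hc, c.radius, c.radius_pos, le_rfl, rfl⟩

/-- `Reg(X̊_φ) ∩ U`, where `X̊_φ = X̄ ∖ 𝓓`. -/
def regularPart (U : Set (CP N)) : Set (CP N) := regularLocus (O.X \ O.divisor) ∩ U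

/-- `g` is a meridian of `Dᵢ` in `U`: there are a regular point `q ∈ Dᵢ` of `X̄` and holomorphic
coordinates `(z₀, z₁)` of `X̄` around `q`, inside `U`, in which `𝓓` is `Dᵢ = {z₁ = 0}`, and `g` is
the class of `γ · ℓ · γ⁻¹`, where `ℓ` is the positively oriented boundary of a disc in the
transversal `{z₀ = 0}` and `γ` is a path from the base point to `ℓ`. -/
def IsMeridian (U : Set (CP N)) (i : Fin O.r) (x₀ : O.regularPart U)
    (g : FundamentalGroup (O.regularPart U) x₀) : Prop :=
  ∃ (q : CP N) (e : QuotientChart O.X q), e.A = ⊥ ∧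
    e.toFun '' Metric.ball (0 : C2) e.radius ⊆ U ∧
    (∀ z ∈ Metric.ball (0 : C2) e.radius, e.toFun z ∈ O.D i ↔ z 1 = 0) ∧
    (∀ j, j ≠ i → ∀ z ∈ Metric.ball (0 : C2) e.radius, e.toFun z ∉ O.D j) ∧
    ∃ ε : ℝ, 0 < ε ∧ ε < e.radius ∧
    ∃ (y : O.regularPart U) (γ : Path x₀ y) (l : Path y y),
      (∀ t : unitInterval, ((l t : O.regularPart U) : CP N) =
        e.toFun !₂[0, (ε : ℂ) * Complex.exp (2 * Real.pi * Complex.I * ((t : ℝ) : ℂ))]) ∧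
      g = FundamentalGroup.fromPath
        (Path.Homotopic.Quotient.mk ((γ.trans l).trans γ.symm))

/-- The subgroup normally generated by the powers `μᵢ^{nᵢ}` of the meridians `μᵢ` of the `Dᵢ`
in `U`. -/
def meridianSubgroup (U : Set (CP N)) (x₀ : O.regularPart U) :
    Subgroup (FundamentalGroup (O.regularPart U) x₀) :=
  Subgroup.normalClosure
    {g | ∃ (i : Fin O.r) (μ : FundamentalGroup (O.regularPart U) x₀),
      O.IsMeridian U i x₀ μ ∧ g = μ ^ O.φ i}

/-- The orbifold fundamental group of `U`; for a small ball `U` around `p` this is the local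
orbifold fundamental group `π₁^orb(X̄, φ)_p`. -/
abbrev LocalOrbifoldGroup (U : Set (CP N)) (x₀ : O.regularPart U) : Type :=
  FundamentalGroup (O.regularPart U) x₀ ⧸ O.meridianSubgroup U x₀

end Orbifold

end OrbifoldSurface

end

noncomputable section

namespace OrbifoldSurface

/-! ### Simple connectivity of punctured balls -/

/-! The proof computes the fundamental group of the regular part of the ball as a deck
transformation group and follows the meridians inside it. Let `K` be the set of coordinate axes of
the adapted chart that lie over components through `p`. The regular part is the image of the points
of the ball whose coordinates in `K` are nonzero, with the origin removed when `A` is nontrivial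
(`regularPart_eq`). Smallness makes `A` act freely away from the origin, so exponentiating the
coordinates in `K` and then dividing by `A` is a covering (`isQuotientCoveringMap_coverMap`). Its
total space is simply connected (`isSimplyConnected_cover`): it is convex if `K` is nonempty or `A`
is trivial, and otherwise it is a punctured ball in real dimension four. Hence the fundamental group
is the group of pairs of an element of `A` and a compatible choice of logarithms of its diagonal
entries in `K`. This group is abelian, an extension of `A` by the lattice of translations by
multiples of `2πi` in the coordinates of `K`.

A meridian of the component under the `m`-th axis corresponds to the translation by `2πi` in that
coordinate. A transversal disc lifts to the chart, and the `m`-th coordinate of the lift has a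
simple zero at the centre (`deriv_lift_transversal_ne_zero`), so it winds exactly once. Conjugation
has no effect in an abelian group, and each component through `p` does have a meridian
(`exists_isMeridian`). The meridian powers therefore generate the sublattice of the multiples by the
`n_m`, of index `∏ n_m` in the lattice, and of index `(∏ n_m) * |A|` in the whole group
(`index_of_lattice`).

The order of `A` is an invariant of the germ (`card_eq`), because two charts at `p` lift to each
other over simply connected punctured balls. This identifies it with `quotientOrder`, and it also
shows that a regular point has only charts with trivial group. -/

theorem homotopic_of_segment_subset {F : Type*} [NormedAddCommGroup F] [NormedSpace ℝ F]
    {s : Set F} {x y : s} (p q : Path x y)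
    (h : ∀ t : unitInterval, segment ℝ (p t : F) (q t) ⊆ s) : p.Homotopic q := by
  refine ⟨⟨⟨⟨fun a => ⟨AffineMap.lineMap (p a.2 : F) (q a.2 : F) (a.1 : ℝ), h a.2 ?_⟩, ?_⟩,
    fun t => ?_, fun t => ?_⟩, fun a t ht => ?_⟩⟩
  · rw [segment_eq_image_lineMap]
    exact ⟨a.1, a.1.2, rfl⟩
  · simp only [AffineMap.lineMap_apply_module]
    fun_prop
  · ext; simp
  · ext; simp
  · rcases ht with rfl | rfl <;> ext <;> simp

/-- Smooth approximation moves the endpoints; adding the linear interpolation of the two endpoint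
errors restores them. Each error is below `m / 2`, so the total stays below `m`. -/
theorem exists_contDiff_loop_near {F : Type*} [NormedAddCommGroup F] [NormedSpace ℝ F]
    [FiniteDimensional ℝ F] {f : ℝ → F} (hf : Continuous f) {m : ℝ} (hm : 0 < m) :
    ∃ g : ℝ → F, ContDiff ℝ 1 g ∧ g 0 = f 0 ∧ g 1 = f 1 ∧
      ∀ t ∈ Set.Icc (0 : ℝ) 1, dist (g t) (f t) < m := by
  obtain ⟨g, hg, hd, -⟩ := hf.exists_contDiff_approx (ε := fun _ => m / 2) 1
    continuous_const (fun _ => half_pos hm)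
  have hg' : ContDiff ℝ 1 g := by exact_mod_cast hg
  refine ⟨fun t => g t + ((1 - t) • (f 0 - g 0) + t • (f 1 - g 1)), by fun_prop, by simp, by simp,
    fun t ht => ?_⟩
  have h0 := hd 0
  have h1 := hd 1
  have h2 := hd t
  rw [dist_eq_norm] at *
  rw [norm_sub_rev] at h0 h1
  calc ‖g t + ((1 - t) • (f 0 - g 0) + t • (f 1 - g 1)) - f t‖
      = ‖(g t - f t) + ((1 - t) • (f 0 - g 0) + t • (f 1 - g 1))‖ := by congr 1; abel
    _ ≤ ‖g t - f t‖ + (‖(1 - t) • (f 0 - g 0)‖ + ‖t • (f 1 - g 1)‖) :=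
        (norm_add_le _ _).trans (by gcongr; exact norm_add_le _ _)
    _ = ‖g t - f t‖ + ((1 - t) * ‖f 0 - g 0‖ + t * ‖f 1 - g 1‖) := by
        rw [norm_smul, norm_smul, Real.norm_of_nonneg ht.1,
          Real.norm_of_nonneg (sub_nonneg.2 ht.2)]
    _ < m := by nlinarith [ht.1, ht.2]

/-- The complement of the closed ray spanned by `v`. -/
def rayCompl {F : Type*} [AddCommGroup F] [Module ℝ F] (v : F) : Set F :=
  {y | ∀ s : ℝ, 0 ≤ s → y ≠ s • v}

theorem starConvex_rayCompl {F : Type*} [AddCommGroup F] [Module ℝ F] {v : F} (hv : v ≠ 0) :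
    StarConvex ℝ (-v) (rayCompl v) := by
  intro y hy a b ha hb hab s hs h
  have hby : b • y = (s + a) • v := by
    rw [add_smul, ← h]; simp
  rcases hb.eq_or_lt with rfl | hb
  · rw [zero_smul, eq_comm, smul_eq_zero] at hby
    rcases hby with h0 | h0
    · linarith
    · exact hv h0
  · refine hy ((s + a) / b) (by positivity) ?_
    rw [div_eq_inv_mul, mul_smul, ← hby, inv_smul_smul₀ hb.ne']

/-- A loop can be made `C¹` by a straight-line homotopy avoiding the origin. A `C¹` loop misses some
ray from the origin when the dimension exceeds two, and the complement of a ray is star-shaped. -/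
theorem isSimplyConnected_compl_zero {F : Type*} [NormedAddCommGroup F] [NormedSpace ℝ F]
    [FiniteDimensional ℝ F] (hF : 2 < Module.finrank ℝ F) :
    IsSimplyConnected ({0}ᶜ : Set F) := by
  refine simply_connected_iff_loops_nullhomotopic.2 ⟨?_, fun x γ => ?_⟩
  · refine isPathConnected_iff_pathConnectedSpace.1 ?_
    refine isPathConnected_compl_singleton_of_one_lt_rank ?_ 0
    rw [← Module.finrank_eq_rank]
    exact_mod_cast (by lia : 1 < Module.finrank ℝ F)
  · set f : ℝ → F := fun t => (γ.extend t : F) with hfdef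
    have hf : Continuous f := by fun_prop
    obtain ⟨t₀, -, ht₀⟩ := isCompact_univ.exists_isMinOn (Set.univ_nonempty (α := unitInterval))
      (f := fun t => ‖(γ t : F)‖) (by fun_prop : Continuous _).continuousOn
    have hm : 0 < ‖(γ t₀ : F)‖ := norm_pos_iff.2 (γ t₀).2
    obtain ⟨g, hg, hg0, hg1, hgd⟩ := exists_contDiff_loop_near hf hm
    have hft : ∀ t : unitInterval, f t = γ t := fun t => by simp [hfdef]
    have hd : ∀ t : unitInterval, dist (g t) (γ t) < ‖(γ t : F)‖ := fun t => by
      have := hgd t t.2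
      rw [hft] at this
      exact this.trans_le (isMinOn_iff.1 ht₀ t (Set.mem_univ _))
    have hseg : ∀ t : unitInterval, segment ℝ (γ t : F) (g t) ⊆ ({0}ᶜ : Set F) := by
      intro t z hz hz0
      rw [Set.mem_singleton_iff] at hz0
      subst hz0
      have h1 : segment ℝ (γ t : F) (g t) ⊆ Metric.ball (γ t : F) ‖(γ t : F)‖ :=
        (convex_ball _ _).segment_subset (Metric.mem_ball_self (norm_pos_iff.2 (γ t).2)) (hd t)
      have := h1 hz
      rw [Metric.mem_ball, dist_zero_left] at this
      exact lt_irrefl _ this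
    have hgne : ∀ t : unitInterval, g t ≠ 0 := fun t => hseg t (right_mem_segment _ _ _)
    have hgs : g 0 = x := by rw [hg0]; simp [hfdef]
    have hgt : g 1 = x := by rw [hg1]; simp [hfdef]
    let q : Path x x :=
      { toFun := fun t => ⟨g t, hgne t⟩
        continuous_toFun := by
          have := hg.continuous
          fun_prop
        source' := by ext; simp [hgs]
        target' := by ext; simp [hgt] }
    refine (homotopic_of_segment_subset γ q hseg).trans ?_
    -- The real cone over the loop is a `C¹` image of the plane, so its complement is dense; any `v`
    -- outside it spans a ray that the loop avoids.
    obtain ⟨v, hv⟩ := (ContDiff.dense_compl_range_of_finrank_lt_finrank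
      (f := fun a : ℝ × ℝ => a.1 • g a.2) (by fun_prop) (by simpa using hF)).nonempty
    have hv0 : v ≠ 0 := fun h => hv ⟨(0, 0), by simp [h]⟩
    have hqT : ∀ t : unitInterval, g t ∈ rayCompl v := fun t s hs h => by
      have hs0 : s ≠ 0 := fun h0 => hgne t (by simp [h, h0])
      exact hv ⟨(s⁻¹, t), by simp [h, hs0]⟩
    have hTsub : rayCompl v ⊆ ({0}ᶜ : Set F) := fun y hy h0 => hy 0 le_rfl (by simpa using h0)
    have : ContractibleSpace (rayCompl v) :=
      (starConvex_rayCompl hv0).contractibleSpace ⟨_, hqT 0⟩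
    have hx : (x : F) ∈ rayCompl v := by simpa [hgs] using hqT 0
    let q' : Path (⟨x, hx⟩ : rayCompl v) ⟨x, hx⟩ :=
      { toFun := fun t => ⟨g t, hqT t⟩
        continuous_toFun := by
          have := hg.continuous
          fun_prop
        source' := by ext; simp [hgs]
        target' := by ext; simp [hgt] }
    have := (SimplyConnectedSpace.paths_homotopic q' (Path.refl _)).map
      ⟨Set.inclusion hTsub, continuous_inclusion hTsub⟩
    exact this

theorem isSimplyConnected_ball_diff_zero {F : Type*} [NormedAddCommGroup F] [NormedSpace ℝ F]
    [FiniteDimensional ℝ F] (hF : 2 < Module.finrank ℝ F) {r : ℝ} (hr : 0 < r) :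
    IsSimplyConnected (Metric.ball (0 : F) r \ {0}) := by
  let e := OpenPartialHomeomorph.univBall (0 : F) r
  have hs : e.source = Set.univ := OpenPartialHomeomorph.univBall_source _ _
  have he : Topology.IsOpenEmbedding e := e.isOpenEmbedding hs
  have him : e '' {0}ᶜ = Metric.ball (0 : F) r \ {0} := by
    rw [Set.image_compl_eq_range_sdiff_image he.injective, ← Set.image_univ, ← hs,
      e.image_source_eq_target, OpenPartialHomeomorph.univBall_target _ hr, Set.image_singleton,
      OpenPartialHomeomorph.univBall_apply_zero]
  rw [← him, he.isEmbedding.isSimplyConnected_image]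
  exact isSimplyConnected_compl_zero hF

/-! ### Topology of projective space -/

theorem continuous_projectivizationMk (N : ℕ) :
    Continuous fun v : {v : Vec N // v ≠ 0} => Projectivization.mk ℂ (v : Vec N) v.2 :=
  continuous_coinduced_rng

theorem eval_smul_of_isHomogeneous {σ R : Type*} [Fintype σ] [CommRing R] {f : MvPolynomial σ R}
    {d : ℕ} (hf : f.IsHomogeneous d) (a : R) (v : σ → R) :
    MvPolynomial.eval (a • v) f = a ^ d * MvPolynomial.eval v f := by
  rw [MvPolynomial.eval_eq', MvPolynomial.eval_eq', Finset.mul_sum]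
  refine Finset.sum_congr rfl fun m hm => ?_
  have : ∑ i, m i = d := by
    rw [← hf (MvPolynomial.mem_support_iff.1 hm), Finsupp.weight_apply,
      Finsupp.sum_fintype _ _ (by simp)]
    simp
  simp only [Pi.smul_apply, smul_eq_mul, mul_pow, Finset.prod_mul_distrib,
    Finset.prod_pow_eq_pow_sum, this]
  ring

/-- By homogeneity, vanishing at the chosen representative is vanishing at every representative.
Closedness of the divisor later lets charts of its complement count as charts of the surface. -/
theorem IsAlgebraic.isClosed {N : ℕ} {Z : Set (CP N)} (hZ : IsAlgebraic Z) : IsClosed Z := by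
  obtain ⟨S, hS, rfl⟩ := hZ
  rw [isClosed_coinduced]
  have : (fun v : {v : Vec N // v ≠ 0} => Projectivization.mk ℂ (v : Vec N) v.2) ⁻¹'
      {q | ∀ f ∈ S, MvPolynomial.eval q.rep f = 0} =
      ⋂ f ∈ S, {v : {v : Vec N // v ≠ 0} | MvPolynomial.eval (v : Vec N) f = 0} := by
    ext v
    simp only [Set.mem_preimage, Set.mem_ofPred_eq, Set.mem_iInter]
    refine forall₂_congr fun f hf => ?_
    obtain ⟨d, hd⟩ := hS f hf
    obtain ⟨a, ha⟩ := Projectivization.exists_smul_eq_mk_rep ℂ (v : Vec N) v.2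
    rw [← ha, Units.smul_def, eval_smul_of_isHomogeneous hd, mul_eq_zero,
      or_iff_right (pow_ne_zero d a.ne_zero)]
  rw [this]
  refine isClosed_biInter fun f _ => isClosed_eq ?_ continuous_const
  exact (MvPolynomial.continuous_eval f).comp continuous_subtype_val

theorem HolomorphicMapAt.continuousAt {N : ℕ} {f : C2 → CP N} {z : C2}
    (hf : HolomorphicMapAt f z) : ContinuousAt f z := by
  obtain ⟨F, hF, h⟩ := hf
  obtain ⟨hz, hfz⟩ := h.self_of_nhds
  have h1 : Filter.Tendsto F (nhdsWithin z {w | F w ≠ 0}) (nhds (F z)) :=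
    hF.continuousAt.mono_left nhdsWithin_le_nhds
  have hU : {w | F w ≠ 0} ∈ nhds z := hF.continuousAt.eventually_ne hz
  have hca : ContinuousAt
      (fun w : {w | F w ≠ 0} => Projectivization.mk ℂ (F w) w.2) ⟨z, hz⟩ := by
    have : ContinuousAt (fun w : {w | F w ≠ 0} => (⟨F w, w.2⟩ : {v : Vec N // v ≠ 0})) ⟨z, hz⟩ :=
      Topology.IsInducing.subtypeVal.continuousAt_iff.2
        (ContinuousAt.comp (f := Subtype.val) hF.continuousAt continuousAt_subtype_val)
    exact (continuous_projectivizationMk N).continuousAt.comp this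
  have hres : ContinuousAt ({w | F w ≠ 0}.domRestrict f) ⟨z, hz⟩ := by
    refine hca.congr ?_
    have := (continuousAt_subtype_val (x := (⟨z, hz⟩ : {w | F w ≠ 0}))).eventually h
    filter_upwards [this] with w hw
    obtain ⟨_, hw⟩ := hw
    exact hw.symm
  rw [← continuousWithinAt_iff_continuousAt_domRestrict] at hres
  exact hres.continuousAt hU

theorem HolomorphicFunctionAt.comp {N : ℕ} {G : CP N → ℂ} {f : C2 → CP N} {z : C2}
    (hG : HolomorphicFunctionAt G (f z)) (hf : HolomorphicMapAt f z) :
    AnalyticAt ℂ (fun w => G (f w)) z := by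
  classical
  obtain ⟨F, hF, h⟩ := hf
  obtain ⟨hz, hfz⟩ := h.self_of_nhds
  refine ((hG (F z) hz hfz.symm).comp hF).congr ?_
  filter_upwards [h] with w ⟨hw, hfw⟩
  simp [hw, hfw]

theorem HolomorphicMapAt.comp {N : ℕ} {f : C2 → CP N} {u : C2 → C2} {z : C2}
    (hf : HolomorphicMapAt f (u z)) (hu : AnalyticAt ℂ u z) :
    HolomorphicMapAt (fun w => f (u w)) z := by
  obtain ⟨F, hF, h⟩ := hf
  exact ⟨fun w => F (u w), hF.comp hu, hu.continuousAt.eventually h⟩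

/-! ### The linear action -/

theorem act_apply (a : Matrix.GeneralLinearGroup (Fin 2) ℂ) (z : C2) (k : Fin 2) :
    act a z k = ∑ j, (a : Matrix (Fin 2) (Fin 2) ℂ) k j * z j := rfl

@[simp] theorem act_one (z : C2) : act 1 z = z := by simp [act]

theorem act_mul (a b : Matrix.GeneralLinearGroup (Fin 2) ℂ) (z : C2) :
    act (a * b) z = act a (act b z) := by
  simp only [act, Units.val_mul, Matrix.mulVec_mulVec]

@[simp] theorem act_zero (a : Matrix.GeneralLinearGroup (Fin 2) ℂ) : act a 0 = 0 := by simp [act]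

theorem act_smul (a : Matrix.GeneralLinearGroup (Fin 2) ℂ) (t : ℂ) (z : C2) :
    act a (t • z) = t • act a z := by
  simp only [act, WithLp.ofLp_smul, Matrix.mulVec_smul, WithLp.toLp_smul]

theorem act_sub (a : Matrix.GeneralLinearGroup (Fin 2) ℂ) (z w : C2) :
    act a (z - w) = act a z - act a w := by
  simp only [act, WithLp.ofLp_sub, Matrix.mulVec_sub, WithLp.toLp_sub]

theorem act_inv_act (a : Matrix.GeneralLinearGroup (Fin 2) ℂ) (z : C2) :
    act a⁻¹ (act a z) = z := by
  rw [← act_mul, inv_mul_cancel, act_one]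

theorem act_act_inv (a : Matrix.GeneralLinearGroup (Fin 2) ℂ) (z : C2) :
    act a (act a⁻¹ z) = z := by
  rw [← act_mul, mul_inv_cancel, act_one]

theorem analyticAt_act (a : Matrix.GeneralLinearGroup (Fin 2) ℂ) (z : C2) :
    AnalyticAt ℂ (act a) z := by
  have : act a = (Matrix.toEuclideanCLM (𝕜 := ℂ) (n := Fin 2) (a : Matrix (Fin 2) (Fin 2) ℂ)) := by
    ext w k
    simp [act]
  rw [this]
  exact ContinuousLinearMap.analyticAt _ _

theorem continuous_act (a : Matrix.GeneralLinearGroup (Fin 2) ℂ) : Continuous (act a) :=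
  continuous_iff_continuousAt.2 fun z => (analyticAt_act a z).continuousAt

theorem act_eq_zero_iff (a : Matrix.GeneralLinearGroup (Fin 2) ℂ) (z : C2) :
    act a z = 0 ↔ z = 0 :=
  ⟨fun h => by rw [← act_inv_act a z, h, act_zero], fun h => by rw [h, act_zero]⟩

/-- A nonzero fixed vector bounds the rank of `a - 1` by one, and smallness excludes rank one. This
is how smallness yields a free action away from the origin. -/
theorem eq_one_of_rank_sub_one_ne_one {a : Matrix.GeneralLinearGroup (Fin 2) ℂ}
    (ha : ((a : Matrix (Fin 2) (Fin 2) ℂ) - 1).rank ≠ 1) {z : C2} (hz : z ≠ 0)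
    (h : act a z = z) : a = 1 := by
  set M := (a : Matrix (Fin 2) (Fin 2) ℂ) - 1 with hM
  have hker : (z.ofLp) ∈ LinearMap.ker M.mulVecLin := by
    have : (a : Matrix (Fin 2) (Fin 2) ℂ).mulVec z.ofLp = z.ofLp := congrArg WithLp.ofLp h
    simp [hM, this]
  have hpos : 0 < Module.finrank ℂ (LinearMap.ker M.mulVecLin) := by
    refine Module.finrank_pos_iff_exists_ne_zero.2 ⟨⟨_, hker⟩, fun h0 => hz ?_⟩
    ext k
    exact congrFun (congrArg Subtype.val h0) k
  have hsum := LinearMap.finrank_range_add_finrank_ker M.mulVecLin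
  rw [Module.finrank_fin_fun] at hsum
  have hr : M.rank = 0 := by
    have : M.rank = Module.finrank ℂ (LinearMap.range M.mulVecLin) := rfl
    lia
  have hM0 : M = 0 := by
    have h0 := LinearMap.range_eq_bot.1 (Submodule.finrank_eq_zero.1 hr)
    exact (Matrix.toLin' (R := ℂ)).map_eq_zero_iff.1 h0
  exact Units.ext (sub_eq_zero.1 hM0)

/-! ### Charts: isometric free action, restriction, recentring. -/

namespace QuotientChart

variable {N : ℕ} {S : Set (CP N)} {p : CP N} (c : QuotientChart S p)

theorem norm_act_le {a : Matrix.GeneralLinearGroup (Fin 2) ℂ} (ha : a ∈ c.A) (z : C2) :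
    ‖act a z‖ ≤ ‖z‖ := by
  by_contra! h
  have h0 : 0 < ‖act a z‖ := (norm_nonneg z).trans_lt h
  have hr := c.radius_pos
  -- Rescale so that the image has norm exactly `c.radius`: the source is inside the open ball while
  -- its image is not.
  have := c.ball_invariant a ha (((c.radius / ‖act a z‖ : ℝ) : ℂ) • z) (by
    rw [mem_ball_zero_iff, norm_smul, Complex.norm_real, Real.norm_of_nonneg (by positivity),
      div_mul_eq_mul_div, div_lt_iff₀ h0]
    gcongr)
  rw [act_smul, mem_ball_zero_iff, norm_smul, Complex.norm_real,
    Real.norm_of_nonneg (by positivity), div_mul_cancel₀ _ h0.ne'] at this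
  exact lt_irrefl _ this

theorem norm_act {a : Matrix.GeneralLinearGroup (Fin 2) ℂ} (ha : a ∈ c.A) (z : C2) :
    ‖act a z‖ = ‖z‖ :=
  (c.norm_act_le ha z).antisymm <| by
    simpa [act_inv_act] using c.norm_act_le (c.A.inv_mem ha) (act a z)

theorem dist_act {a : Matrix.GeneralLinearGroup (Fin 2) ℂ} (ha : a ∈ c.A) (z w : C2) :
    dist (act a z) (act a w) = dist z w := by
  rw [dist_eq_norm, dist_eq_norm, ← act_sub, c.norm_act ha]

theorem eq_one_of_act_eq {a : Matrix.GeneralLinearGroup (Fin 2) ℂ} (ha : a ∈ c.A) {z : C2}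
    (hz : c.A ≠ ⊥ → z ≠ 0) (h : act a z = z) : a = 1 := by
  by_cases hA : c.A = ⊥
  · rw [hA] at ha
    exact Subgroup.mem_bot.1 ha
  · exact eq_one_of_rank_sub_one_ne_one (c.small_A a ha) (hz hA) h

theorem zero_mem : (0 : C2) ∈ Metric.ball (0 : C2) c.radius := Metric.mem_ball_self c.radius_pos

theorem toFun_eq_iff_eq_zero {z : C2} (hz : z ∈ Metric.ball (0 : C2) c.radius) :
    c.toFun z = p ↔ z = 0 := by
  refine ⟨fun h => ?_, fun h => by rw [h, c.map_zero]⟩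
  obtain ⟨a, -, rfl⟩ := (c.fibres 0 c.zero_mem z hz).1 (by rw [h, c.map_zero])
  rw [act_zero]

theorem toFun_act {a : Matrix.GeneralLinearGroup (Fin 2) ℂ} (ha : a ∈ c.A) {z : C2}
    (hz : z ∈ Metric.ball (0 : C2) c.radius) : c.toFun (act a z) = c.toFun z :=
  ((c.fibres z hz _ (c.ball_invariant a ha z hz)).2 ⟨a, ha, rfl⟩).symm

theorem continuousAt {z : C2} (hz : z ∈ Metric.ball (0 : C2) c.radius) :
    ContinuousAt c.toFun z := (c.holomorphic z hz).continuousAt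

/-- The restriction of a chart to a smaller ball. -/
def restrict (ρ : ℝ) (hρ : 0 < ρ) (hle : ρ ≤ c.radius) : QuotientChart S p where
  A := c.A
  finite_A := c.finite_A
  comm_A := c.comm_A
  small_A := c.small_A
  radius := ρ
  radius_pos := hρ
  ball_invariant a ha z hz := by
    rw [mem_ball_zero_iff] at hz ⊢
    rwa [c.norm_act ha]
  toFun := c.toFun
  map_zero := c.map_zero
  map_mem z hz := c.map_mem z (Metric.ball_subset_ball hle hz)
  holomorphic z hz := c.holomorphic z (Metric.ball_subset_ball hle hz)
  fibres z hz w hw :=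
    c.fibres z (Metric.ball_subset_ball hle hz) w (Metric.ball_subset_ball hle hw)
  open_map O hO hsub := c.open_map O hO (hsub.trans (Metric.ball_subset_ball hle))
  functions O hO hsub := c.functions O hO (hsub.trans (Metric.ball_subset_ball hle))

/-- A chart of an open subset is a chart. -/
def ofInterOpen {V : Set (CP N)} (hV : IsOpen V) (c : QuotientChart (S ∩ V) p) :
    QuotientChart S p where
  A := c.A
  finite_A := c.finite_A
  comm_A := c.comm_A
  small_A := c.small_A
  radius := c.radius
  radius_pos := c.radius_pos
  ball_invariant := c.ball_invariant
  toFun := c.toFun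
  map_zero := c.map_zero
  map_mem z hz := (c.map_mem z hz).1
  holomorphic := c.holomorphic
  fibres := c.fibres
  open_map O hO hsub := by
    obtain ⟨W, hW, h⟩ := c.open_map O hO hsub
    exact ⟨W ∩ V, hW.inter hV, by rw [h, Set.inter_assoc, Set.inter_comm V]⟩
  functions := c.functions

/-- A chart whose image lies in `V` is a chart of the intersection with `V`. -/
def interOfMapsTo (V : Set (CP N))
    (h : ∀ z ∈ Metric.ball (0 : C2) c.radius, c.toFun z ∈ V) : QuotientChart (S ∩ V) p where
  A := c.A
  finite_A := c.finite_A
  comm_A := c.comm_A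
  small_A := c.small_A
  radius := c.radius
  radius_pos := c.radius_pos
  ball_invariant := c.ball_invariant
  toFun := c.toFun
  map_zero := c.map_zero
  map_mem z hz := ⟨c.map_mem z hz, h z hz⟩
  holomorphic := c.holomorphic
  fibres := c.fibres
  open_map O hO hsub := by
    obtain ⟨W, hW, hO'⟩ := c.open_map O hO hsub
    refine ⟨W, hW, Set.Subset.antisymm ?_ ?_⟩
    · rintro _ ⟨z, hz, rfl⟩
      have : c.toFun z ∈ W ∩ S := hO' ▸ Set.mem_image_of_mem _ hz
      exact ⟨this.1, this.2, h z (hsub hz)⟩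
    · rw [hO']
      exact Set.inter_subset_inter_right _ Set.inter_subset_left
  functions := c.functions

theorem exists_radius_free {x : C2} (hx : x ∈ Metric.ball (0 : C2) c.radius)
    (hfree : c.A ≠ ⊥ → x ≠ 0) :
    ∃ δ > 0, Metric.ball x δ ⊆ Metric.ball (0 : C2) c.radius ∧
      ∀ a ∈ c.A, ∀ y ∈ Metric.ball x δ, act a y ∈ Metric.ball x δ → a = 1 := by
  have := c.finite_A
  have h1 : ∀ a : c.A, ∃ δ > 0, (a : Matrix.GeneralLinearGroup (Fin 2) ℂ) ≠ 1 →
      2 * δ ≤ dist (act a x) x := fun a => by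
    by_cases ha : (a : Matrix.GeneralLinearGroup (Fin 2) ℂ) = 1
    · exact ⟨1, one_pos, fun h => (h ha).elim⟩
    · have : 0 < dist (act a x) x :=
        dist_pos.2 fun h => ha (c.eq_one_of_act_eq a.2 hfree h)
      exact ⟨dist (act a x) x / 2, by positivity, fun _ => by linarith⟩
  choose δ hδ h using h1
  obtain ⟨ε, hε, hball⟩ := Metric.isOpen_iff.1 Metric.isOpen_ball x hx
  obtain ⟨a₀, ha₀⟩ := Finite.exists_min δ
  -- `δ` is at most half the smallest displacement of `x`. Since `A` acts by isometries, `y` and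
  -- `act a y` both within `δ` of `x` would force a displacement smaller than `2 * δ`.
  refine ⟨min ε (δ a₀), lt_min hε (hδ _),
    (Metric.ball_subset_ball (min_le_left _ _)).trans hball, fun a ha y hy hay => ?_⟩
  by_contra hne
  have h2 := h ⟨a, ha⟩ hne
  have h3 : dist (act a x) x ≤ dist (act a x) (act a y) + dist (act a y) x := dist_triangle _ _ _
  rw [c.dist_act ha, dist_comm x y] at h3
  rw [Metric.mem_ball] at hy hay
  have h4 := ha₀ ⟨a, ha⟩
  have h5 := min_le_right ε (δ a₀)
  simp only at h2
  linarith

/-- Near a point with trivial stabilizer the quotient map is injective, so composing with a rigid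
motion gives a smooth chart. The isometry `L` allows a choice of which axis becomes `z 1 = 0`, and
`η` bounds the radius. -/
theorem exists_chart_translate {x : C2} (hx : x ∈ Metric.ball (0 : C2) c.radius)
    (hfree : c.A ≠ ⊥ → x ≠ 0) (L : C2 ≃ₗᵢ[ℂ] C2) {η : ℝ} (hη : 0 < η) :
    ∃ e : QuotientChart S (c.toFun x), e.A = ⊥ ∧ e.radius ≤ η ∧
      Metric.ball x e.radius ⊆ Metric.ball (0 : C2) c.radius ∧
      e.toFun = fun w => c.toFun (x + L w) := by
  classical
  obtain ⟨δ', hδ', hsub', hfr'⟩ := c.exists_radius_free hx hfree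
  set δ := min δ' η with hδdef
  have hδ : 0 < δ := lt_min hδ' hη
  have hss : Metric.ball x δ ⊆ Metric.ball x δ' := Metric.ball_subset_ball (min_le_left _ _)
  have hsub := hss.trans hsub'
  have hfr : ∀ a ∈ c.A, ∀ y ∈ Metric.ball x δ, act a y ∈ Metric.ball x δ → a = 1 :=
    fun a ha y hy hay => hfr' a ha y (hss hy) (hss hay)
  have hmem : ∀ w ∈ Metric.ball (0 : C2) δ, x + L w ∈ Metric.ball x δ := fun w hw => by
    rw [mem_ball_zero_iff] at hw
    simpa [Metric.mem_ball, dist_eq_norm] using hw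
  have hana : ∀ w, AnalyticAt ℂ (fun w => x + L w) w := fun w =>
    analyticAt_const.add (L.toContinuousLinearEquiv.toContinuousLinearMap.analyticAt w)
  have hhom : ∀ O : Set C2, (fun w => x + L w) '' O = {y | L.symm (y - x) ∈ O} := by
    intro O
    ext y
    constructor
    · rintro ⟨w, hw, rfl⟩
      simpa using hw
    · intro hy
      exact ⟨_, hy, by simp⟩
  have hopen : ∀ O : Set C2, IsOpen O → IsOpen {y | L.symm (y - x) ∈ O} := fun O hO =>
    hO.preimage (by fun_prop)
  have hOsub : ∀ O ⊆ Metric.ball (0 : C2) δ, {y | L.symm (y - x) ∈ O} ⊆ Metric.ball x δ := by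
    intro O hO
    rw [← hhom]
    rintro _ ⟨w, hw, rfl⟩
    exact hmem w (hO hw)
  refine ⟨
    { A := ⊥
      finite_A := inferInstance
      comm_A := fun a ha b hb => by rw [Subgroup.mem_bot.1 ha, Subgroup.mem_bot.1 hb]
      small_A := fun a ha => by rw [Subgroup.mem_bot.1 ha]; simp
      radius := δ
      radius_pos := hδ
      ball_invariant := fun a ha z hz => by rwa [Subgroup.mem_bot.1 ha, act_one]
      toFun := fun w => c.toFun (x + L w)
      map_zero := by simp
      map_mem := fun z hz => c.map_mem _ (hsub (hmem z hz))
      holomorphic := fun z hz => HolomorphicMapAt.comp (u := fun w => x + L w)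
        (c.holomorphic _ (hsub (hmem z hz))) (hana z)
      fibres := fun z hz w hw => ?_
      open_map := fun O hO hOs => ?_
      functions := fun O hO hOs hinv g hg hginv z hz => ?_ }, rfl, min_le_right _ _, hsub, rfl⟩
  · constructor
    · intro h
      obtain ⟨a, ha, haw⟩ := (c.fibres _ (hsub (hmem z hz)) _ (hsub (hmem w hw))).1 h
      have := hfr a ha _ (hmem z hz) (haw ▸ hmem w hw)
      subst this
      refine ⟨1, Subgroup.mem_bot.2 rfl, ?_⟩
      simpa using haw
    · rintro ⟨a, ha, rfl⟩
      rw [Subgroup.mem_bot.1 ha, act_one]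
  · obtain ⟨W, hW, h⟩ := c.open_map _ (hopen O hO) ((hOsub O hOs).trans hsub)
    refine ⟨W, hW, ?_⟩
    rw [← h, ← hhom, Set.image_image]
  · set T := {y | L.symm (y - x) ∈ O} with hT
    have hTb : T ⊆ Metric.ball x δ := hOsub O hOs
    -- The descent axiom applies only to invariant functions on invariant sets. The translates of
    -- `T` are disjoint by freeness, so `g` extends uniquely to an invariant function on their
    -- union.
    let O' : Set C2 := ⋃ a ∈ c.A, act a ⁻¹' T
    let g' : C2 → ℂ := fun y =>
      if h : ∃ a ∈ c.A, act a y ∈ T then g (L.symm (act h.choose y - x)) else 0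
    have hg' : ∀ a ∈ c.A, ∀ y, act a y ∈ T → g' y = g (L.symm (act a y - x)) := by
      intro a ha y hy
      have hex : ∃ a ∈ c.A, act a y ∈ T := ⟨a, ha, hy⟩
      have hb := hex.choose_spec
      have heq : hex.choose = a := by
        have := hfr _ (c.A.mul_mem ha (c.A.inv_mem hb.1)) (act hex.choose y) (hTb hb.2)
          (by rw [act_mul, act_inv_act]; exact hTb hy)
        exact (mul_inv_eq_one.1 this).symm
      simp only [g', dif_pos hex]
      rw [heq]
    have hO'sub : O' ⊆ Metric.ball (0 : C2) c.radius := by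
      intro y hy
      simp only [O', Set.mem_iUnion] at hy
      obtain ⟨a, ha, hay⟩ := hy
      have := hsub (hTb hay)
      rw [mem_ball_zero_iff, c.norm_act ha] at this
      exact mem_ball_zero_iff.2 this
    have hzT : x + L z ∈ T := by simpa [hT] using hz
    obtain ⟨G, hG, hev⟩ := c.functions O'
      (isOpen_biUnion fun a _ => (hopen O hO).preimage (continuous_act a)) hO'sub
      (by
        intro a ha y hy
        simp only [O', Set.mem_iUnion] at hy ⊢
        obtain ⟨b, hb, hby⟩ := hy
        refine ⟨b * a⁻¹, c.A.mul_mem hb (c.A.inv_mem ha), ?_⟩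
        rw [Set.mem_preimage, act_mul, act_inv_act]
        exact hby) g'
      (by
        intro y hy
        simp only [O', Set.mem_iUnion] at hy
        obtain ⟨a, ha, hay⟩ := hy
        have h1 : AnalyticAt ℂ (fun y => g (L.symm (act a y - x))) y := by
          have h2 : AnalyticAt ℂ (fun y => L.symm (act a y - x)) y :=
            AnalyticAt.comp (f := fun y => act a y - x)
              (L.symm.toContinuousLinearEquiv.toContinuousLinearMap.analyticAt _)
              ((analyticAt_act a y).sub analyticAt_const)
          exact AnalyticAt.comp (f := fun y => L.symm (act a y - x)) (hg _ hay) h2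
        refine h1.congr ?_
        filter_upwards [((hopen O hO).preimage (continuous_act a)).mem_nhds hay] with w hw
        exact (hg' a ha w hw).symm)
      (by
        intro a ha y hy
        simp only [O', Set.mem_iUnion] at hy
        obtain ⟨b, hb, hby⟩ := hy
        rw [hg' b hb y hby, hg' (b * a⁻¹) (c.A.mul_mem hb (c.A.inv_mem ha)) (act a y)
          (by rw [act_mul, act_inv_act]; exact hby), act_mul, act_inv_act])
      (x + L z)
      (by
        simp only [O', Set.mem_iUnion]
        exact ⟨1, c.A.one_mem, by rwa [Set.mem_preimage, act_one]⟩)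
    refine ⟨G, hG, ?_⟩
    have := (hana z).continuousAt.eventually hev
    filter_upwards [this, hO.mem_nhds hz] with w hw hwO
    rw [← hw, hg' 1 c.A.one_mem _ (by rw [act_one]; simpa [hT] using hwO), act_one]
    simp

/-- Coordinates are not `A`-invariant, but they descend locally where the action is free. This is
what turns continuous lifts into holomorphic ones. -/
theorem exists_nhds_eq_holomorphicFunction {x : C2} (hx : x ∈ Metric.ball (0 : C2) c.radius)
    (hfree : c.A ≠ ⊥ → x ≠ 0) (k : Fin 2) :
    ∃ G : CP N → ℂ, HolomorphicFunctionAt G (c.toFun x) ∧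
      ∀ᶠ y in nhds x, y k = G (c.toFun y) := by
  obtain ⟨e, heA, -, -, he⟩ := c.exists_chart_translate hx hfree
    (LinearIsometryEquiv.refl ℂ C2) one_pos
  obtain ⟨G, hG, h⟩ := e.functions (Metric.ball 0 e.radius) Metric.isOpen_ball subset_rfl
    e.ball_invariant (fun z => x k + z k)
    (fun z _ => analyticAt_const.add
      ((EuclideanSpace.proj k : C2 →L[ℂ] ℂ).analyticAt z))
    (fun a ha z _ => by rw [heA] at ha; rw [Subgroup.mem_bot.1 ha, act_one]) 0 e.zero_mem
  rw [e.map_zero] at hG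
  refine ⟨G, hG, ?_⟩
  have ht : Filter.Tendsto (fun y : C2 => y - x) (nhds x) (nhds 0) := by
    have : Continuous fun y : C2 => y - x := by fun_prop
    simpa using this.tendsto x
  filter_upwards [ht.eventually h] with y hy
  simpa [he] using hy

end QuotientChart

/-! ### Exponential coordinates -/

/-- The exponential function in the coordinates in `K`, the identity in the others. -/
def expOn (K : Finset (Fin 2)) (u : Fin 2 → ℂ) : C2 :=
  WithLp.toLp 2 fun k => if k ∈ K then Complex.exp (u k) else u k

theorem expOn_apply_mem {K : Finset (Fin 2)} {k : Fin 2} (hk : k ∈ K) (u : Fin 2 → ℂ) :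
    expOn K u k = Complex.exp (u k) := if_pos hk

theorem expOn_apply_notMem {K : Finset (Fin 2)} {k : Fin 2} (hk : k ∉ K) (u : Fin 2 → ℂ) :
    expOn K u k = u k := if_neg hk

theorem expOn_empty (u : Fin 2 → ℂ) : expOn ∅ u = WithLp.toLp 2 u := by
  ext k
  exact expOn_apply_notMem (Finset.notMem_empty k) u

theorem continuous_expOn (K : Finset (Fin 2)) : Continuous (expOn K) := by
  refine (PiLp.continuous_toLp 2 _).comp (continuous_pi fun k => ?_)
  by_cases hk : k ∈ K
  · simp only [hk, if_true]
    fun_prop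
  · simp only [hk, if_false]
    fun_prop

theorem isOpenMap_expOn (K : Finset (Fin 2)) : IsOpenMap (expOn K) := by
  have h1 : IsOpenMap (Pi.map fun k : Fin 2 => if k ∈ K then Complex.exp else id) := by
    refine IsOpenMap.piMap (fun k => ?_) ?_
    · by_cases hk : k ∈ K
      · simpa only [hk, if_true] using Complex.isOpenMap_exp
      · simpa only [hk, if_false] using IsOpenMap.id
    · simp
  have h2 : IsOpenMap (WithLp.toLp 2 : (Fin 2 → ℂ) → C2) :=
    (PiLp.homeomorph 2 fun _ : Fin 2 => ℂ).symm.isOpenMap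
  have h3 : expOn K = WithLp.toLp 2 ∘
      Pi.map fun k : Fin 2 => if k ∈ K then Complex.exp else id := by
    ext u k
    by_cases hk : k ∈ K <;> simp [expOn, hk]
  rw [h3]
  exact h2.comp h1

theorem exists_expOn_eq {K : Finset (Fin 2)} {z : C2} (hz : ∀ k ∈ K, z k ≠ 0) :
    ∃ u, expOn K u = z := by
  refine ⟨fun k => if k ∈ K then Complex.log (z k) else z k, ?_⟩
  ext k
  by_cases hk : k ∈ K
  · simp [expOn, hk, Complex.exp_log (hz k hk)]
  · simp [expOn, hk]

theorem norm_exp_convexOn {u v : ℂ} {a b : ℝ} (ha : 0 ≤ a) (hb : 0 ≤ b) (hab : a + b = 1) :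
    ‖Complex.exp (a • u + b • v)‖ ≤ a * ‖Complex.exp u‖ + b * ‖Complex.exp v‖ := by
  simp only [Complex.norm_exp, Complex.add_re, Complex.real_smul, Complex.re_ofReal_mul]
  exact convexOn_exp.2 (Set.mem_univ _) (Set.mem_univ _) ha hb hab

/-- The modulus of `exp` is a convex function of its argument, as is that of the identity, and the
Euclidean norm is monotone in the moduli of the coordinates. -/
theorem convex_preimage_expOn (K : Finset (Fin 2)) (r : ℝ) :
    Convex ℝ (expOn K ⁻¹' Metric.ball (0 : C2) r) := by
  intro u hu v hv a b ha hb hab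
  have key : ∀ k, ‖expOn K (a • u + b • v) k‖ ≤ a * ‖expOn K u k‖ + b * ‖expOn K v k‖ := by
    intro k
    by_cases hk : k ∈ K
    · simp only [expOn_apply_mem hk]
      exact norm_exp_convexOn ha hb hab
    · simp only [expOn_apply_notMem hk]
      refine (norm_add_le _ _).trans_eq ?_
      simp [abs_of_nonneg ha, abs_of_nonneg hb]
  -- Replacing the coordinates by their moduli keeps the norms and reduces the claim to convexity of
  -- the ball.
  let x : C2 := WithLp.toLp 2 fun k => (‖expOn K u k‖ : ℂ)
  let y : C2 := WithLp.toLp 2 fun k => (‖expOn K v k‖ : ℂ)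
  have hx : ‖x‖ = ‖expOn K u‖ := by simp [x, EuclideanSpace.norm_eq]
  have hy : ‖y‖ = ‖expOn K v‖ := by simp [y, EuclideanSpace.norm_eq]
  have hle : ‖expOn K (a • u + b • v)‖ ≤ ‖a • x + b • y‖ := by
    rw [EuclideanSpace.norm_eq, EuclideanSpace.norm_eq]
    refine Real.sqrt_le_sqrt (Finset.sum_le_sum fun k _ => ?_)
    refine pow_le_pow_left₀ (norm_nonneg _) ((key k).trans_eq ?_) 2
    have : (a • x + b • y) k = ((a * ‖expOn K u k‖ + b * ‖expOn K v k‖ : ℝ) : ℂ) := by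
      simp [x, y]
    rw [this, Complex.norm_real, Real.norm_of_nonneg (by positivity)]
  rw [Set.mem_preimage, mem_ball_zero_iff] at *
  refine hle.trans_lt ?_
  have := convex_ball (0 : C2) r (x := x) (by rw [mem_ball_zero_iff, hx]; exact hu)
    (y := y) (by rw [mem_ball_zero_iff, hy]; exact hv) ha hb hab
  exact mem_ball_zero_iff.1 this

/-! ### The covering space over the regular part. -/

namespace QuotientChart

variable {N : ℕ} {S : Set (CP N)} {p : CP N} (c : QuotientChart S p) (K : Finset (Fin 2))

/-- The part of the ball of a chart on which `A` acts freely. -/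
def freeBall : Set C2 := {z | z ∈ Metric.ball (0 : C2) c.radius ∧ (c.A ≠ ⊥ → z ≠ 0)}

theorem isOpen_freeBall : IsOpen c.freeBall := by
  by_cases h : c.A = ⊥
  · simp only [freeBall, h, ne_eq, not_true_eq_false, false_imp_iff, and_true]
    exact Metric.isOpen_ball
  · simp only [freeBall, h, ne_eq, not_false_eq_true, true_imp_iff]
    exact Metric.isOpen_ball.inter isOpen_compl_singleton

theorem act_mem_freeBall {a : Matrix.GeneralLinearGroup (Fin 2) ℂ} (ha : a ∈ c.A) {z : C2}
    (hz : z ∈ c.freeBall) : act a z ∈ c.freeBall :=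
  ⟨c.ball_invariant a ha z hz.1, fun h h0 => hz.2 h ((act_eq_zero_iff a z).1 h0)⟩

/-- The covering space of the part of the ball on which the coordinates in `K` do not vanish. -/
def cover : Set (Fin 2 → ℂ) := expOn K ⁻¹' c.freeBall

theorem isOpen_cover : IsOpen (c.cover K) := c.isOpen_freeBall.preimage (continuous_expOn K)

/-- If `K` is nonempty the exponential already avoids the origin, and if `A` is trivial the origin
is allowed; in both cases the set is convex. Only for empty `K` and nontrivial `A` is it a punctured
ball. -/
theorem isSimplyConnected_cover : IsSimplyConnected (c.cover K) := by
  by_cases h : K.Nonempty ∨ c.A = ⊥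
  · have hc : c.cover K = expOn K ⁻¹' Metric.ball (0 : C2) c.radius := by
      ext u
      refine ⟨fun hu => hu.1, fun hu => ⟨hu, fun hA h0 => ?_⟩⟩
      rcases h with ⟨k, hk⟩ | h
      · have := expOn_apply_mem hk u
        rw [h0] at this
        exact Complex.exp_ne_zero _ this.symm
      · exact hA h
    have hne : (c.cover K).Nonempty := by
      obtain ⟨u, hu⟩ := exists_expOn_eq (K := K)
        (z := WithLp.toLp 2 fun _ => ((c.radius / 2 : ℝ) : ℂ)) (fun k _ => by
          simpa using c.radius_pos.ne')
      refine ⟨u, ?_⟩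
      rw [hc, Set.mem_preimage, hu, mem_ball_zero_iff, EuclideanSpace.norm_eq]
      have hr := c.radius_pos
      rw [Real.sqrt_lt' hr]
      simp only [Complex.norm_real, Fin.sum_univ_two, Real.norm_of_nonneg (half_pos hr).le]
      nlinarith
    have := (convex_preimage_expOn K c.radius).contractibleSpace (hc ▸ hne)
    rw [hc]
    exact (inferInstance : SimplyConnectedSpace (expOn K ⁻¹' Metric.ball (0 : C2) c.radius))
  · push Not at h
    obtain ⟨rfl, hA⟩ := h
    have h1 : c.cover ∅ = (PiLp.homeomorph 2 fun _ : Fin 2 => ℂ).symm ⁻¹'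
        (Metric.ball (0 : C2) c.radius \ {0}) := by
      ext u
      simp only [cover, Set.mem_preimage, expOn_empty, freeBall, hA, Set.mem_ofPred_eq, ne_eq,
        not_false_eq_true, true_imp_iff]
      rfl
    rw [h1, Homeomorph.isSimplyConnected_preimage]
    refine isSimplyConnected_ball_diff_zero ?_ c.radius_pos
    rw [← Module.finrank_mul_finrank ℝ ℂ C2]
    simp

/-! ### Deck transformations -/

/-- The group of deck transformations of the covering space `c.cover K`: the pairs of `a ∈ A` and
a translation in the coordinates in `K` that lifts `a`. -/
def deckGroup : Subgroup (Matrix.GeneralLinearGroup (Fin 2) ℂ × Multiplicative (Fin 2 → ℂ)) where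
  carrier := {g | g.1 ∈ c.A ∧
    (∀ k ∈ K, ∀ j, (g.1 : Matrix (Fin 2) (Fin 2) ℂ) k j =
      if j = k then Complex.exp (g.2.toAdd k) else 0) ∧
    ∀ k ∉ K, g.2.toAdd k = 0}
  one_mem' := by
    refine ⟨c.A.one_mem, fun k _ j => ?_, fun k _ => rfl⟩
    simp [Matrix.one_apply, eq_comm]
  mul_mem' := by
    rintro ⟨a, t⟩ ⟨b, s⟩ ⟨ha, hat, ht⟩ ⟨hb, hbs, hs⟩
    refine ⟨c.A.mul_mem ha hb, fun k hk j => ?_, fun k hk => ?_⟩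
    · have h1 := hat k hk
      have h2 := hbs k hk
      simp only at h1 h2
      simp only [Prod.mk_mul_mk, Units.val_mul, Matrix.mul_apply, h1, ite_mul, zero_mul,
        Finset.sum_ite_eq', Finset.mem_univ, if_true, h2, mul_ite, mul_zero, toAdd_mul,
        Pi.add_apply, Complex.exp_add]
    · simp [ht k hk, hs k hk]
  inv_mem' := by
    rintro ⟨a, t⟩ ⟨ha, hat, ht⟩
    refine ⟨c.A.inv_mem ha, fun k hk j => ?_, fun k hk => ?_⟩
    · have h1 : ((a : Matrix (Fin 2) (Fin 2) ℂ) * ((a⁻¹ : Matrix.GeneralLinearGroup (Fin 2) ℂ) :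
          Matrix (Fin 2) (Fin 2) ℂ)) k j = (1 : Matrix (Fin 2) (Fin 2) ℂ) k j := by
        rw [← Units.val_mul, mul_inv_cancel, Units.val_one]
      have h2 := hat k hk
      simp only at h2
      simp only [Matrix.mul_apply, h2, ite_mul, zero_mul, Finset.sum_ite_eq', Finset.mem_univ,
        if_true, Matrix.one_apply] at h1
      simp only [Prod.inv_mk, toAdd_inv, Pi.neg_apply, Complex.exp_neg]
      rw [← mul_right_inj' (Complex.exp_ne_zero (t.toAdd k)), h1, mul_ite, mul_zero,
        mul_inv_cancel₀ (Complex.exp_ne_zero _)]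
      simp only [eq_comm]
    · simp [ht k hk]

variable {K} in
theorem deckGroup_mul_comm (g h : c.deckGroup K) : g * h = h * g := by
  refine Subtype.ext (Prod.ext ?_ ?_)
  · exact c.comm_A _ g.2.1 _ h.2.1
  · exact mul_comm _ _

variable {K} in
-- In a coordinate of `K` the matrix acts by the scalar `exp t`, which lifts to translation by `t`.
-- The other coordinates are not unwound, so there the linear action is used unchanged.
theorem expOn_deck {g : Matrix.GeneralLinearGroup (Fin 2) ℂ × Multiplicative (Fin 2 → ℂ)}
    (hg : g ∈ c.deckGroup K) (u : Fin 2 → ℂ) :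
    expOn K (fun k => if k ∈ K then u k + g.2.toAdd k else act g.1 (expOn K u) k) =
      act g.1 (expOn K u) := by
  ext k
  by_cases hk : k ∈ K
  · rw [expOn_apply_mem hk, act_apply, if_pos hk, Finset.sum_eq_single k
      (fun j _ hj => by rw [hg.2.1 k hk, if_neg hj, zero_mul]) (by simp), hg.2.1 k hk, if_pos rfl,
      expOn_apply_mem hk, Complex.exp_add, mul_comm]
  · rw [expOn_apply_notMem hk, if_neg hk]

instance : SMul (c.deckGroup K) (c.cover K) where
  smul g u := ⟨fun k => if k ∈ K then u.1 k + g.1.2.toAdd k else act g.1.1 (expOn K u) k, by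
    have := c.act_mem_freeBall g.2.1 u.2
    rwa [← c.expOn_deck g.2] at this⟩

variable {K}

theorem deck_smul_apply_mem {k : Fin 2} (hk : k ∈ K) (g : c.deckGroup K) (u : c.cover K) :
    (g • u : c.cover K).1 k = u.1 k + g.1.2.toAdd k := if_pos hk

theorem deck_smul_apply_notMem {k : Fin 2} (hk : k ∉ K) (g : c.deckGroup K) (u : c.cover K) :
    (g • u : c.cover K).1 k = act g.1.1 (expOn K u) k := if_neg hk

theorem expOn_deck_smul (g : c.deckGroup K) (u : c.cover K) :
    expOn K (g • u : c.cover K) = act g.1.1 (expOn K u) :=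
  c.expOn_deck g.2 u

instance : MulAction (c.deckGroup K) (c.cover K) where
  one_smul u := by
    refine Subtype.ext (funext fun k => ?_)
    by_cases hk : k ∈ K
    · rw [c.deck_smul_apply_mem hk]
      simp
    · rw [c.deck_smul_apply_notMem hk, Subgroup.coe_one, Prod.fst_one, act_one,
        expOn_apply_notMem hk]
  mul_smul g h u := by
    refine Subtype.ext (funext fun k => ?_)
    by_cases hk : k ∈ K
    · rw [c.deck_smul_apply_mem hk, c.deck_smul_apply_mem hk, c.deck_smul_apply_mem hk]
      simp only [Subgroup.coe_mul, Prod.snd_mul, toAdd_mul, Pi.add_apply]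
      ring
    · rw [c.deck_smul_apply_notMem hk, c.deck_smul_apply_notMem hk, c.expOn_deck_smul,
        ← act_mul]
      rfl

/-- The covering map onto the image of the points at which the coordinates in `K` do not
vanish. -/
def coverMap {R : Set (CP N)} (hR : R = c.toFun '' {z ∈ c.freeBall | ∀ k ∈ K, z k ≠ 0}) :
    c.cover K → R :=
  fun u => ⟨c.toFun (expOn K u), by
    rw [hR]
    exact ⟨_, ⟨u.2, fun k hk => by rw [expOn_apply_mem hk]; exact Complex.exp_ne_zero _⟩, rfl⟩⟩

variable (K) in
/-- `A` preserves the coordinate axes `{z_k = 0}` for `k ∈ K`. -/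
def PreservesAxes : Prop :=
  ∀ a ∈ c.A, ∀ k ∈ K, ∀ j, j ≠ k → (a : Matrix (Fin 2) (Fin 2) ℂ) k j = 0

theorem preservesAxes_empty : c.PreservesAxes ∅ := fun _ _ _ hk => (Finset.notMem_empty _ hk).elim

/-- Two points with the same image differ by some `a ∈ A` after exponentiation. As `a` preserves the
axes in `K`, the differences of their coordinates in `K` are logarithms of diagonal entries of `a`,
giving the deck transformation. -/
theorem isQuotientCoveringMap_coverMap (hK : c.PreservesAxes K) {R : Set (CP N)}
    (hR : R = c.toFun '' {z ∈ c.freeBall | ∀ k ∈ K, z k ≠ 0}) :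
    IsQuotientCoveringMap (c.coverMap hR) (c.deckGroup K) := by
  have hcont : Continuous (c.coverMap hR) := by
    refine Continuous.subtype_mk (continuous_iff_continuousAt.2 fun u => ?_) _
    exact ContinuousAt.comp (f := fun u : c.cover K => expOn K u) (c.continuousAt u.2.1)
      ((continuous_expOn K).comp continuous_subtype_val).continuousAt
  have hsurj : Function.Surjective (c.coverMap hR) := by
    rintro ⟨x, hx⟩
    have hx' := hx
    rw [hR] at hx'
    obtain ⟨z, ⟨hz, hzK⟩, rfl⟩ := hx'
    obtain ⟨u, rfl⟩ := exists_expOn_eq hzK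
    exact ⟨⟨u, hz⟩, rfl⟩
  have hopen : IsOpenMap (c.coverMap hR) := by
    intro O hO
    obtain ⟨W, hW, h⟩ := c.open_map (expOn K '' (Subtype.val '' O))
      (isOpenMap_expOn K _ ((c.isOpen_cover K).isOpenMap_subtype_val O hO)) (by
        rintro _ ⟨_, ⟨u, -, rfl⟩, rfl⟩
        exact u.2.1)
    have : c.coverMap hR '' O = Subtype.val ⁻¹' W := by
      ext x
      constructor
      · rintro ⟨u, hu, rfl⟩
        have : c.toFun (expOn K u) ∈ W ∩ S := by
          rw [← h]
          exact ⟨_, ⟨_, ⟨u, hu, rfl⟩, rfl⟩, rfl⟩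
        exact this.1
      · intro hx
        obtain ⟨u, rfl⟩ := hsurj x
        have : c.toFun (expOn K u) ∈ W ∩ S := ⟨hx, c.map_mem _ u.2.1⟩
        rw [← h] at this
        obtain ⟨_, ⟨_, ⟨v, hv, rfl⟩, rfl⟩, huv⟩ := this
        exact ⟨v, hv, Subtype.ext huv⟩
    rw [this]
    exact hW.preimage continuous_subtype_val
  refine
    { toIsQuotientMap := hopen.isQuotientMap hcont hsurj
      continuous_const_smul := fun g => ?_
      apply_eq_iff_mem_orbit := fun {e₁ e₂} => ?_
      disjoint := fun e => ?_ }
  · refine Continuous.subtype_mk (continuous_pi fun k => ?_) _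
    by_cases hk : k ∈ K
    · simp only [hk, if_true]
      exact ((continuous_apply k).comp continuous_subtype_val).add continuous_const
    · simp only [hk, if_false]
      have h1 : Continuous fun u : c.cover K => act g.1.1 (expOn K u) :=
        (continuous_act _).comp ((continuous_expOn K).comp continuous_subtype_val)
      exact (EuclideanSpace.proj k : C2 →L[ℂ] ℂ).continuous.comp h1
  · constructor
    · intro h
      obtain ⟨a, ha, hae⟩ := (c.fibres _ e₂.2.1 _ e₁.2.1).1 (congrArg Subtype.val h).symm
      refine ⟨⟨(a, Multiplicative.ofAdd fun k => if k ∈ K then e₁.1 k - e₂.1 k else 0),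
        ha, fun k hk j => ?_, fun k hk => ?_⟩, ?_⟩
      · by_cases hj : j = k
        · subst hj
          have h1 : expOn K e₁ j = act a (expOn K e₂) j := by rw [hae]
          rw [act_apply, Finset.sum_eq_single j
            (fun i _ hi => by rw [hK a ha j hk i hi, zero_mul]) (by simp),
            expOn_apply_mem hk, expOn_apply_mem hk] at h1
          simp only [toAdd_ofAdd, hk, if_true, Complex.exp_sub, h1]
          field_simp
        · rw [if_neg hj]
          exact hK a ha k hk j hj
      · simp [hk]
      · refine Subtype.ext (funext fun k => ?_)
        by_cases hk : k ∈ K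
        · exact (c.deck_smul_apply_mem hk _ _).trans (by simp [hk])
        · exact (c.deck_smul_apply_notMem hk _ _).trans
            (by rw [← hae, expOn_apply_notMem hk])
    · rintro ⟨g, rfl⟩
      refine Subtype.ext ?_
      change c.toFun (expOn K (g • e₂ : c.cover K)) = c.toFun (expOn K e₂)
      rw [c.expOn_deck_smul, c.toFun_act g.2.1 e₂.2.1]
  · obtain ⟨δ, hδ, -, hfr⟩ := c.exists_radius_free e.2.1 e.2.2
    -- The first set forces the component in `A` to be trivial, which leaves translations by
    -- multiples of `2πi`. The unit ball bounds these by `2 < 2π`, so they vanish.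
    refine ⟨{u | expOn K u ∈ Metric.ball (expOn K e) δ} ∩ {u | u.1 ∈ Metric.ball e.1 1},
      Filter.inter_mem ?_ ?_, ?_⟩
    · have : Continuous fun u : c.cover K => expOn K u :=
        (continuous_expOn K).comp continuous_subtype_val
      exact this.continuousAt (Metric.ball_mem_nhds _ hδ)
    · exact continuous_subtype_val.continuousAt (Metric.ball_mem_nhds _ one_pos)
    · rintro g ⟨_, ⟨u, hu, rfl⟩, hgu⟩
      have h1 : g.1.1 = 1 := hfr _ g.2.1 _ hu.1 (by
        have := hgu.1
        simp only [Set.mem_ofPred_eq] at this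
        rwa [c.expOn_deck_smul] at this)
      refine Subtype.ext (Prod.ext h1 ?_)
      change g.1.2.toAdd = 0
      funext k
      by_cases hk : k ∈ K
      · have h2 := g.2.2.1 k hk k
        rw [h1, if_pos rfl, Units.val_one, Matrix.one_apply_eq] at h2
        obtain ⟨m, hm⟩ := Complex.exp_eq_one_iff.1 h2.symm
        have h3 : ‖g.1.2.toAdd k‖ < 2 := by
          have ha := (dist_le_pi_dist (g • u : c.cover K).1 e.1 k).trans_lt hgu.2
          have hb := (dist_le_pi_dist u.1 e.1 k).trans_lt hu.2
          rw [c.deck_smul_apply_mem hk, dist_eq_norm] at ha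
          rw [dist_eq_norm] at hb
          calc ‖g.1.2.toAdd k‖ = ‖(u.1 k + g.1.2.toAdd k - e.1 k) - (u.1 k - e.1 k)‖ := by
                congr 1; ring
            _ ≤ _ := norm_sub_le _ _
            _ < 2 := by linarith
        have hm0 : m = 0 := by
          by_contra hm0
          rw [hm] at h3
          have h4 : (1 : ℝ) ≤ |(m : ℝ)| := by exact_mod_cast Int.one_le_abs hm0
          simp only [Complex.norm_mul, Complex.norm_intCast, Complex.norm_ofNat,
            Complex.norm_real, Complex.norm_I, Real.norm_of_nonneg Real.pi_pos.le] at h3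
          nlinarith [Real.pi_gt_three]
        rw [hm, hm0]
        simp
      · exact g.2.2.2 k hk

end QuotientChart

/-! ### Lifting maps to charts; the order of the group of a chart -/

namespace QuotientChart

variable {N : ℕ} {S : Set (CP N)} {p : CP N} (c : QuotientChart S p)

theorem image_freeBall_eq :
    c.toFun '' c.freeBall = c.toFun '' {z ∈ c.freeBall | ∀ k ∈ (∅ : Finset (Fin 2)), z k ≠ 0} := by
  simp

/-- This is the covering above with empty `K`, namely the quotient of the free part of the ball by
`A`. -/
theorem exists_lift {T : Type*} [TopologicalSpace T] [SimplyConnectedSpace T]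
    [LocallyPathConnectedSpace T] {h : T → CP N} (hc : Continuous h)
    (hmem : ∀ t, h t ∈ c.toFun '' c.freeBall) :
    ∃ f : T → C2, Continuous f ∧ ∀ t, f t ∈ c.freeBall ∧ c.toFun (f t) = h t := by
  have hq := c.isQuotientCoveringMap_coverMap c.preservesAxes_empty c.image_freeBall_eq
  obtain ⟨t₀⟩ : Nonempty T := inferInstance
  obtain ⟨e₀, he₀⟩ := hq.surjective ⟨h t₀, hmem t₀⟩
  obtain ⟨F, ⟨-, hF⟩, -⟩ := hq.isCoveringMap.existsUnique_continuousMap_lifts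
    ⟨fun t => (⟨h t, hmem t⟩ : c.toFun '' c.freeBall), by fun_prop⟩ t₀ e₀ he₀
  refine ⟨fun t => expOn ∅ (F t), (continuous_expOn ∅).comp
    (continuous_subtype_val.comp F.continuous), fun t => ⟨(F t).2, ?_⟩⟩
  exact congrArg Subtype.val (congrFun hF t)

theorem lift_unique {T : Type*} [TopologicalSpace T] [PreconnectedSpace T] {f g : T → C2}
    (hf : Continuous f) (hg : Continuous g) (hfm : ∀ t, f t ∈ c.freeBall)
    (hgm : ∀ t, g t ∈ c.freeBall) (h : ∀ t, c.toFun (f t) = c.toFun (g t)) {t₀ : T}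
    (h₀ : f t₀ = g t₀) : f = g := by
  have hq := c.isQuotientCoveringMap_coverMap c.preservesAxes_empty c.image_freeBall_eq
  have hof : Continuous (WithLp.ofLp : C2 → Fin 2 → ℂ) := PiLp.continuous_ofLp 2 _
  have hcov : ∀ z ∈ c.freeBall, z.ofLp ∈ c.cover ∅ := fun z hz => by
    rw [cover, Set.mem_preimage, expOn_empty]
    exact hz
  have key := hq.isCoveringMap.eq_of_comp_eq
    (g₁ := fun t => ⟨(f t).ofLp, hcov _ (hfm t)⟩)
    (g₂ := fun t => ⟨(g t).ofLp, hcov _ (hgm t)⟩)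
    (Continuous.subtype_mk (f := fun t => (f t).ofLp) (hof.comp hf) fun t => hcov _ (hfm t))
    (Continuous.subtype_mk (f := fun t => (g t).ofLp) (hof.comp hg) fun t => hcov _ (hgm t))
    (funext fun t => Subtype.ext (by
      simp only [coverMap, Function.comp_apply, expOn_empty]
      exact h t)) t₀ (Subtype.ext (congrArg WithLp.ofLp h₀))
  funext t
  exact WithLp.ofLp_injective 2 (congrArg Subtype.val (congrFun key t))

theorem mem_image_freeBall {z : C2} (hz : z ∈ Metric.ball (0 : C2) c.radius)
    (h : c.A ≠ ⊥ → c.toFun z ≠ p) : c.toFun z ∈ c.toFun '' c.freeBall :=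
  ⟨z, ⟨hz, fun hA h0 => h hA (by rw [h0, c.map_zero])⟩, rfl⟩

theorem exists_restrict_mapsTo (c' : QuotientChart S p) :
    ∃ ρ, 0 < ρ ∧ ρ ≤ c'.radius ∧
      ∀ z ∈ Metric.ball (0 : C2) ρ, c'.toFun z ∈ c.toFun '' Metric.ball (0 : C2) c.radius := by
  obtain ⟨W, hW, h⟩ := c.open_map _ Metric.isOpen_ball subset_rfl
  have hp : p ∈ W := by
    have : c.toFun 0 ∈ W ∩ S := h ▸ Set.mem_image_of_mem _ c.zero_mem
    rw [c.map_zero] at this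
    exact this.1
  have hWn : c'.toFun ⁻¹' W ∈ nhds (0 : C2) :=
    c'.continuousAt c'.zero_mem (hW.mem_nhds (by rwa [c'.map_zero]))
  obtain ⟨ε, hε, hb⟩ := Metric.mem_nhds_iff.1 hWn
  refine ⟨min ε c'.radius, lt_min hε c'.radius_pos, min_le_right _ _, fun z hz => ?_⟩
  rw [h]
  exact ⟨hb (Metric.ball_subset_ball (min_le_left _ _) hz),
    c'.map_mem z (Metric.ball_subset_ball (min_le_right _ _) hz)⟩

theorem isSimplyConnected_puncturedBall {r : ℝ} (hr : 0 < r) :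
    IsSimplyConnected (Metric.ball (0 : C2) r \ {0}) := by
  refine isSimplyConnected_ball_diff_zero ?_ hr
  rw [← Module.finrank_mul_finrank ℝ ℂ C2]
  simp

theorem exists_lift_puncturedBall (c' : QuotientChart S p) {ρ : ℝ} (hρ : 0 < ρ)
    (hle : ρ ≤ c'.radius)
    (h : ∀ z ∈ Metric.ball (0 : C2) ρ,
      c'.toFun z ∈ c.toFun '' Metric.ball (0 : C2) c.radius) :
    ∃ f : (Metric.ball (0 : C2) ρ \ {0} : Set C2) → C2, Continuous f ∧
      ∀ t, f t ∈ c.freeBall ∧ c.toFun (f t) = c'.toFun t ∧ f t ≠ 0 := by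
  have hs := isSimplyConnected_puncturedBall hρ
  have := hs.simplyConnectedSpace
  have : LocallyPathConnectedSpace (Metric.ball (0 : C2) ρ \ {0} : Set C2) :=
    (Metric.isOpen_ball.inter isOpen_compl_singleton).locallyPathConnectedSpace
  have hball : ∀ t : (Metric.ball (0 : C2) ρ \ {0} : Set C2),
      (t : C2) ∈ Metric.ball (0 : C2) c'.radius := fun t => Metric.ball_subset_ball hle t.2.1
  have hp : ∀ t : (Metric.ball (0 : C2) ρ \ {0} : Set C2), c'.toFun t ≠ p := fun t ht =>
    t.2.2 ((c'.toFun_eq_iff_eq_zero (hball t)).1 ht)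
  obtain ⟨f, hf, hfm⟩ := c.exists_lift
    (T := (Metric.ball (0 : C2) ρ \ {0} : Set C2)) (h := fun t => c'.toFun t)
    (continuous_iff_continuousAt.2 fun t =>
      (c'.continuousAt (hball t)).comp continuous_subtype_val.continuousAt) (fun t => by
      obtain ⟨x, hx, hxt⟩ := h t t.2.1
      rw [← hxt]
      exact c.mem_image_freeBall hx fun _ => by rw [hxt]; exact hp t)
  exact ⟨f, hf, fun t => ⟨(hfm t).1, (hfm t).2,
    fun h0 => hp t (by rw [← (hfm t).2, h0, c.map_zero])⟩⟩

/-- Lift each chart through the other on punctured balls. The composite of the two lifts covers the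
identity, so by connectedness it is the action of one `a₀ ∈ A`. Comparing the values of `g` on the
orbit of a base point gives a map between the groups, injective because the composite is injective
and the action is free; no homomorphism property is needed. -/
theorem card_le_of_mapsTo (c' : QuotientChart S p)
    (h : ∀ z ∈ Metric.ball (0 : C2) c'.radius,
      c'.toFun z ∈ c.toFun '' Metric.ball (0 : C2) c.radius) :
    Nat.card c.A ≤ Nat.card c'.A := by
  obtain ⟨f, hf, hfm⟩ := c.exists_lift_puncturedBall c' c'.radius_pos le_rfl h
  obtain ⟨ρ, hρ, hρle, hρm⟩ := c'.exists_restrict_mapsTo c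
  obtain ⟨g, hg, hgm⟩ := c'.exists_lift_puncturedBall c hρ hρle hρm
  have hs := isSimplyConnected_puncturedBall hρ
  have := hs.simplyConnectedSpace
  obtain ⟨x₀⟩ : Nonempty (Metric.ball (0 : C2) ρ \ {0} : Set C2) := inferInstance
  let fg : (Metric.ball (0 : C2) ρ \ {0} : Set C2) → C2 :=
    fun t => f ⟨g t, (hgm t).1.1, (hgm t).2.2⟩
  have hfg : Continuous fg := hf.comp (Continuous.subtype_mk hg _)
  have hcfg : ∀ t, c.toFun (fg t) = c.toFun t := fun t => by
    rw [(hfm _).2.1, (hgm t).2.1]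
  have hball : ∀ t : (Metric.ball (0 : C2) ρ \ {0} : Set C2),
      (t : C2) ∈ Metric.ball (0 : C2) c.radius := fun t => Metric.ball_subset_ball hρle t.2.1
  obtain ⟨a₀, ha₀, h₀⟩ := (c.fibres _ (hball x₀) _ (hfm _).1.1).1 (hcfg x₀).symm
  have hact : fg = act a₀ ∘ Subtype.val := by
    refine c.lift_unique hfg ((continuous_act a₀).comp continuous_subtype_val)
      (fun t => (hfm _).1) (fun t => c.act_mem_freeBall ha₀ ⟨hball t, fun _ => t.2.2⟩)
      (fun t => ?_) h₀
    rw [hcfg, Function.comp_apply, c.toFun_act ha₀ (hball t)]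
  have hmem : ∀ a : c.A, act a x₀ ∈ (Metric.ball (0 : C2) ρ \ {0} : Set C2) := fun a =>
    ⟨by rw [mem_ball_zero_iff, c.norm_act a.2]; exact mem_ball_zero_iff.1 x₀.2.1,
      fun h0 => x₀.2.2 ((act_eq_zero_iff _ _).1 h0)⟩
  have hex : ∀ a : c.A, ∃ a' ∈ c'.A, g ⟨act a x₀, hmem a⟩ = act a' (g x₀) := fun a => by
    refine (c'.fibres _ (hgm _).1.1 _ (hgm _).1.1).1 ?_
    rw [(hgm _).2.1, (hgm _).2.1, c.toFun_act a.2 (hball x₀)]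
  choose ψ hψ hgψ using hex
  have := c'.finite_A
  refine Nat.card_le_card_of_injective (fun a => (⟨ψ a, hψ a⟩ : c'.A)) fun a b hab => ?_
  have h1 : ψ a = ψ b := congrArg Subtype.val hab
  have h2 : fg ⟨act a x₀, hmem a⟩ = fg ⟨act b x₀, hmem b⟩ := by
    simp only [fg, hgψ, h1]
  rw [hact] at h2
  have h3 : act a (x₀ : C2) = act b x₀ := by
    have := congrArg (act a₀⁻¹) h2
    simpa only [Function.comp_apply, act_inv_act] using this
  have h4 := c.eq_one_of_act_eq (c.A.mul_mem (c.A.inv_mem b.2) a.2) (z := x₀)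
    (fun _ => x₀.2.2) (by rw [act_mul, h3, act_inv_act])
  exact Subtype.ext (inv_mul_eq_one.1 h4).symm

theorem card_le (c' : QuotientChart S p) : Nat.card c.A ≤ Nat.card c'.A := by
  obtain ⟨ρ, hρ, hle, h⟩ := c.exists_restrict_mapsTo c'
  exact c.card_le_of_mapsTo (c'.restrict ρ hρ hle) h

theorem card_eq (c' : QuotientChart S p) : Nat.card c.A = Nat.card c'.A :=
  (c.card_le c').antisymm (c'.card_le c)

theorem eq_bot_of_eq_bot (c' : QuotientChart S p) (h : c'.A = ⊥) : c.A = ⊥ := by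
  refine (Subgroup.card_eq_one).1 ?_
  rw [c.card_eq c', h, Subgroup.card_bot]

theorem quotientOrder_eq : quotientOrder S p = Nat.card c.A := by
  have h : Nonempty (QuotientChart S p) := ⟨c⟩
  rw [quotientOrder, dif_pos h]
  exact h.some.card_eq c

end QuotientChart

/-! ### Adapted charts -/

namespace Orbifold

variable {N : ℕ} (O : Orbifold N)

theorem isClosed_divisor : IsClosed O.divisor :=
  isClosed_iUnion_of_finite fun i => (O.variety_D i).1.isClosed

/-- `k` assigns to the components through `p` the axes of the chart `c` lying over them. -/
def IsAdaptedBy {p : CP N} (c : QuotientChart O.X p) (k : Fin O.r → Fin 2) : Prop :=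
  Set.InjOn k {i | p ∈ O.D i} ∧
    ∀ i, ∀ z ∈ Metric.ball (0 : C2) c.radius, c.toFun z ∈ O.D i ↔ p ∈ O.D i ∧ z (k i) = 0

open Classical in
/-- The axes of an adapted chart lying over the divisor. -/
def axes (p : CP N) (k : Fin O.r → Fin 2) : Finset (Fin 2) :=
  (Finset.univ.filter fun i => p ∈ O.D i).image k

variable {O} {p : CP N} {c : QuotientChart O.X p} {k : Fin O.r → Fin 2}

theorem mem_axes {m : Fin 2} : m ∈ O.axes p k ↔ ∃ i, p ∈ O.D i ∧ k i = m := by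
  simp [axes]

namespace IsAdaptedBy

variable (h : O.IsAdaptedBy c k)
include h

theorem preservesAxes : c.PreservesAxes (O.axes p k) := by
  intro a ha m hm j hj
  obtain ⟨i, hi, rfl⟩ := mem_axes.1 hm
  have hr := c.radius_pos
  -- A vector on the axis `z m = 0`. Its image under `a` lies over the same component, and the
  -- `m`-th coordinate of that image is a nonzero multiple of the entry to be killed.
  let z : C2 := EuclideanSpace.single j ((c.radius / 2 : ℝ) : ℂ)
  have hz : z ∈ Metric.ball (0 : C2) c.radius := by
    rw [mem_ball_zero_iff, PiLp.norm_single, Complex.norm_real,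
      Real.norm_of_nonneg (by positivity)]
    linarith
  have h1 : c.toFun z ∈ O.D i := (h.2 i z hz).2 ⟨hi, by simp [z, hj.symm]⟩
  rw [← c.toFun_act ha hz, h.2 i _ (c.ball_invariant a ha z hz), act_apply,
    Finset.sum_eq_single j (fun l _ hl => by simp [z, hl]) (by simp)] at h1
  simpa [z, hr.ne'] using h1.2

theorem notMem_divisor_iff {z : C2} (hz : z ∈ Metric.ball (0 : C2) c.radius) :
    c.toFun z ∉ O.divisor ↔ ∀ m ∈ O.axes p k, z m ≠ 0 := by
  simp only [divisor, Set.mem_iUnion, not_exists, h.2 _ z hz, mem_axes]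
  constructor
  · rintro H m ⟨i, hi, rfl⟩ h0
    exact H i ⟨hi, h0⟩
  · rintro H i ⟨hi, h0⟩
    exact H _ ⟨i, hi, rfl⟩ h0

/-- Away from the origin a recentred chart shows regularity. At the origin, regularity of `p` forces
`A` to be trivial by invariance of its order. -/
theorem regularPart_eq : O.regularPart (c.toFun '' Metric.ball (0 : C2) c.radius) =
    c.toFun '' {z ∈ c.freeBall | ∀ m ∈ O.axes p k, z m ≠ 0} := by
  ext x
  constructor
  · rintro ⟨⟨⟨-, hxD⟩, e, he⟩, z, hz, rfl⟩
    refine ⟨z, ⟨⟨hz, fun hA h0 => hA ?_⟩, (h.notMem_divisor_iff hz).1 hxD⟩, rfl⟩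
    subst h0
    have hp := c.map_zero
    revert e
    rw [hp]
    intro e he
    exact c.eq_bot_of_eq_bot
      (QuotientChart.ofInterOpen (V := O.divisorᶜ) O.isClosed_divisor.isOpen_compl e) he
  · rintro ⟨z, ⟨hz, hzK⟩, rfl⟩
    have hzD := (h.notMem_divisor_iff hz.1).2 hzK
    have hopen : {y : C2 | ∀ m ∈ O.axes p k, y m ≠ 0} ∈ nhds z := by
      refine IsOpen.mem_nhds ?_ hzK
      have : {y : C2 | ∀ m ∈ O.axes p k, y m ≠ 0} = ⋂ m ∈ O.axes p k, {y : C2 | y m ≠ 0} := by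
        ext; simp
      rw [this]
      refine isOpen_biInter_finset fun m _ => isOpen_ne_fun ?_ continuous_const
      exact (EuclideanSpace.proj m : C2 →L[ℂ] ℂ).continuous
    obtain ⟨η, hη, hball⟩ := Metric.mem_nhds_iff.1 hopen
    obtain ⟨e, heA, heη, hesub, he⟩ := c.exists_chart_translate hz.1 hz.2
      (LinearIsometryEquiv.refl ℂ C2) hη
    refine ⟨⟨⟨c.map_mem z hz.1, hzD⟩, e.interOfMapsTo O.divisorᶜ (fun w hw => ?_), heA⟩,
      z, hz.1, rfl⟩
    have hw' : z + w ∈ Metric.ball z e.radius := by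
      rw [mem_ball_zero_iff] at hw
      simpa [Metric.mem_ball, dist_eq_norm] using hw
    rw [he]
    exact (h.notMem_divisor_iff (hesub hw')).2 (hball (Metric.ball_subset_ball heη hw'))

/-- The universal covering of the regular part. -/
theorem isQuotientCoveringMap :
    IsQuotientCoveringMap (c.coverMap h.regularPart_eq) (c.deckGroup (O.axes p k)) :=
  c.isQuotientCoveringMap_coverMap h.preservesAxes h.regularPart_eq

end IsAdaptedBy

end Orbifold

/-! ### Covering maps and logarithms -/

/-- Monodromy commutes with deck transformations. In an abelian group the loop `l` therefore moves
every point over `y` by the same `g`, and the transports along `γ` and back cancel. -/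
theorem fundamentalGroupToMulOpposite_conj {E X G : Type*} [TopologicalSpace E]
    [TopologicalSpace X] [Group G] [MulAction G E] {f : E → X} (hf : IsQuotientCoveringMap f G)
    (hG : ∀ g h : G, g * h = h * g) {x y : X} (e : f ⁻¹' {x}) (γ : Path x y) (l : Path y y)
    {L : unitInterval → E} (hL : Continuous L) (hLl : ∀ t, f (L t) = l t) {g : G}
    (hg : L 1 = g • L 0) :
    hf.fundamentalGroupToMulOpposite e
      (FundamentalGroup.fromPath (Path.Homotopic.Quotient.mk ((γ.trans l).trans γ.symm))) =
      MulOpposite.op g := by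
  have cov := hf.isCoveringMap
  have hsm : ∀ {a b : X} (δ : Path.Homotopic.Quotient a b) (s : G) (u : f ⁻¹' {a}),
      cov.monodromy δ (hf.toPermFiber a s u) = hf.toPermFiber b s (cov.monodromy δ u) :=
    fun δ s u => hf.monodromy_toPermFiber
  have hl0 : f (L 0) = y := by rw [hLl]; exact l.source
  have hl1 : f (L 1) = y := by rw [hLl]; exact l.target
  let L' : Path (L 0) (L 1) := ⟨⟨L, hL⟩, rfl, rfl⟩
  have hL0 : cov.monodromy (Path.Homotopic.Quotient.mk l) ⟨L 0, hl0⟩ = ⟨L 1, hl1⟩ := by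
    refine cov.monodromy_eq_of_map_eq (Path.Homotopic.Quotient.mk L') ?_
    refine congrArg Path.Homotopic.Quotient.mk ?_
    ext t
    exact hLl t
  have hloop : ∀ u : f ⁻¹' {y},
      cov.monodromy (Path.Homotopic.Quotient.mk l) u = hf.toPermFiber y g u := by
    intro u
    obtain ⟨s, rfl⟩ := hf.exists_toPermFiber_eq ⟨L 0, hl0⟩ u
    rw [hsm, hL0]
    refine Subtype.ext ?_
    simp only [IsQuotientCoveringMap.toPermFiber_apply_apply_coe, hg, ← mul_smul, hG]
  rw [hf.fundamentalGroupToMulOpposite_apply_eq_Iff]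
  change g • e.1 = (cov.monodromy (((Path.Homotopic.Quotient.mk γ).trans
    (Path.Homotopic.Quotient.mk l)).trans (Path.Homotopic.Quotient.mk γ).symm) e).1
  rw [cov.monodromy_trans_apply, cov.monodromy_trans_apply, hloop, hsm,
    ← cov.monodromy_trans_apply, Path.Homotopic.Quotient.trans_symm, cov.monodromy_refl]
  simp

theorem exists_continuous_log {T : Type*} [TopologicalSpace T] [SimplyConnectedSpace T]
    [LocallyPathConnectedSpace T] {f : T → ℂ} (hf : Continuous f) (h0 : ∀ t, f t ≠ 0) :
    ∃ H : T → ℂ, Continuous H ∧ ∀ t, Complex.exp (H t) = f t := by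
  obtain ⟨t₀⟩ : Nonempty T := inferInstance
  obtain ⟨H, ⟨-, hH⟩, -⟩ := Complex.isCoveringMapOn_exp.existsUnique_continuousMap_lifts
    ⟨f, hf⟩ (a₀ := t₀) (e₀ := Complex.log (f t₀)) (Complex.exp_log (h0 t₀)) h0
  exact ⟨H, H.continuous, congrFun hH⟩

/-- The quotient `f w / w`, completed at the origin by the derivative, is continuous and nowhere
zero on a disc, hence has a continuous logarithm. -/
theorem exists_eq_mul_exp {R : ℝ} (hR : 0 < R) {f : ℂ → ℂ}
    (hf : ContinuousOn f (Metric.ball 0 R)) (hf0 : f 0 = 0)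
    (hne : ∀ w ∈ Metric.ball (0 : ℂ) R, w ≠ 0 → f w ≠ 0) (hd : DifferentiableAt ℂ f 0)
    (hd0 : deriv f 0 ≠ 0) :
    ∃ H : Metric.ball (0 : ℂ) R → ℂ, Continuous H ∧
      ∀ w : Metric.ball (0 : ℂ) R, (w : ℂ) * Complex.exp (H w) = f w := by
  have hmem := Metric.ball_mem_nhds (0 : ℂ) hR
  have hc := continuousOn_iff_continuous_domRestrict.1
    ((continuousOn_dslope hmem).2 ⟨hf, hd⟩)
  have : ContractibleSpace (Metric.ball (0 : ℂ) R) := Metric.contractibleSpace_ball hR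
  have : LocallyPathConnectedSpace (Metric.ball (0 : ℂ) R) :=
    Metric.isOpen_ball.locallyPathConnectedSpace
  have hds : ∀ w : ℂ, w * dslope f 0 w = f w := fun w => by
    have := sub_smul_dslope f 0 w
    simpa [hf0] using this
  obtain ⟨H, hH, hexp⟩ := exists_continuous_log hc fun w => by
    by_cases hw : (w : ℂ) = 0
    · simpa [Set.domRestrict, hw, dslope_same] using hd0
    · intro h0
      have h1 := hds w
      rw [show dslope f 0 w = 0 from h0, mul_zero] at h1
      exact hne w w.2 hw h1.symm
  exact ⟨H, hH, fun w => by rw [hexp, Set.domRestrict_apply, hds]⟩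

/-! ### Meridians -/

/-- The point of `ℂ²` with coordinates `(0, w)`. -/
def transversal (w : ℂ) : C2 := !₂[0, w]

theorem transversal_eq (w : ℂ) : transversal w = EuclideanSpace.single 1 w := by
  ext k
  fin_cases k <;> simp [transversal]

theorem transversal_apply_one (w : ℂ) : transversal w 1 = w := by simp [transversal]

theorem transversal_zero : transversal 0 = 0 := by rw [transversal_eq]; simp

theorem norm_transversal (w : ℂ) : ‖transversal w‖ = ‖w‖ := by
  rw [transversal_eq, PiLp.norm_single]

theorem analyticAt_transversal (w : ℂ) : AnalyticAt ℂ transversal w := by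
  have h : transversal = fun w : ℂ => w • (EuclideanSpace.single 1 1 : C2) := by
    ext w k
    rw [transversal_eq]
    simp
  rw [h]
  exact analyticAt_id.smul analyticAt_const

theorem transversal_mem_ball {w : ℂ} {r : ℝ} :
    transversal w ∈ Metric.ball (0 : C2) r ↔ w ∈ Metric.ball (0 : ℂ) r := by
  rw [mem_ball_zero_iff, mem_ball_zero_iff, norm_transversal]

namespace QuotientChart

variable {N : ℕ} {S : Set (CP N)} {p q : CP N} (c : QuotientChart S p) (e : QuotientChart S q)

theorem exists_lift_transversal
    (hmem : ∀ w ∈ Metric.ball (0 : ℂ) e.radius, e.toFun (transversal w) ∈ c.toFun '' c.freeBall) :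
    ∃ F : ℂ → C2, ContinuousOn F (Metric.ball 0 e.radius) ∧
      ∀ w ∈ Metric.ball (0 : ℂ) e.radius,
        F w ∈ c.freeBall ∧ c.toFun (F w) = e.toFun (transversal w) := by
  classical
  have : ContractibleSpace (Metric.ball (0 : ℂ) e.radius) :=
    Metric.contractibleSpace_ball e.radius_pos
  have : LocallyPathConnectedSpace (Metric.ball (0 : ℂ) e.radius) :=
    Metric.isOpen_ball.locallyPathConnectedSpace
  obtain ⟨f, hf, hfm⟩ := c.exists_lift (T := Metric.ball (0 : ℂ) e.radius)
    (h := fun w => e.toFun (transversal w))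
    (continuous_iff_continuousAt.2 fun w => by
      refine ContinuousAt.comp (f := fun w : Metric.ball (0 : ℂ) e.radius => transversal w)
        (e.continuousAt (transversal_mem_ball.2 w.2)) ?_
      exact (analyticAt_transversal w).continuousAt.comp continuous_subtype_val.continuousAt)
    (fun w => hmem w w.2)
  refine ⟨fun w => if h : w ∈ Metric.ball (0 : ℂ) e.radius then f ⟨w, h⟩ else 0, ?_, fun w hw => ?_⟩
  · rw [continuousOn_iff_continuous_domRestrict]
    refine hf.congr fun w => ?_
    simp [Set.domRestrict, -Metric.mem_ball, w.2]
  · simpa only [dif_pos hw] using hfm ⟨w, hw⟩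

variable {c e}

/-- The lift is only known to be continuous. Locally its coordinates are holomorphic functions on
the surface, composed with the holomorphic disc. -/
theorem differentiableAt_lift_transversal {F : ℂ → C2} (hF : ContinuousAt F 0)
    (hF0 : F 0 ∈ c.freeBall)
    (hlift : ∀ᶠ w in nhds 0, c.toFun (F w) = e.toFun (transversal w)) :
    DifferentiableAt ℂ F 0 := by
  rw [differentiableAt_piLp]
  intro m
  obtain ⟨G, hG, hev⟩ := c.exists_nhds_eq_holomorphicFunction hF0.1 hF0.2 m
  rw [hlift.self_of_nhds] at hG
  have h1 : AnalyticAt ℂ (fun w => G (e.toFun (transversal w))) 0 :=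
    AnalyticAt.comp (f := transversal) (hG.comp (e.holomorphic _ (by
      rw [transversal_zero]
      exact e.zero_mem))) (analyticAt_transversal 0)
  refine h1.differentiableAt.congr_of_eventuallyEq ?_
  filter_upwards [hF.eventually hev, hlift] with w h2 h3
  rw [h2, h3]

/-- Pull the coordinate `z 1` of `e` back to the chart `c`. Along the lifted disc it is the
identity, so its differential sends `deriv F 0` to one; but it vanishes on the axis `x m = 0`, so
its differential sees only the `m`-th component. -/
theorem deriv_lift_transversal_ne_zero (heA : e.A = ⊥) {F : ℂ → C2} (hF : ContinuousAt F 0)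
    (hF0 : F 0 ∈ c.freeBall)
    (hlift : ∀ᶠ w in nhds 0, c.toFun (F w) = e.toFun (transversal w)) {m : Fin 2}
    (hm : F 0 m = 0)
    (haxis : ∀ x ∈ Metric.ball (0 : C2) c.radius, x m = 0 →
      ∀ z ∈ Metric.ball (0 : C2) e.radius, c.toFun x = e.toFun z → z 1 = 0) :
    deriv (fun w => F w m) 0 ≠ 0 := by
  have hdiff := differentiableAt_lift_transversal hF hF0 hlift
  have hFq : c.toFun (F 0) = q := by
    rw [hlift.self_of_nhds, transversal_zero, e.map_zero]
  obtain ⟨G, hG, hev⟩ := e.exists_nhds_eq_holomorphicFunction e.zero_mem (fun h => (h heA).elim) 1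
  rw [e.map_zero, ← hFq] at hG
  have hψ : AnalyticAt ℂ (fun x => G (c.toFun x)) (F 0) := hG.comp (c.holomorphic _ hF0.1)
  obtain ⟨V, hV, hVo, h0V⟩ := eventually_nhds_iff.1
    (hev.and (Metric.isOpen_ball.eventually_mem e.zero_mem))
  -- Openness of `e` provides a preimage near its centre, where `G` really is the coordinate `z 1`.
  have hzero : ∀ᶠ x in nhds (F 0), x m = 0 → G (c.toFun x) = 0 := by
    obtain ⟨W, hW, hWV⟩ := e.open_map V hVo fun z hz => (hV z hz).2
    have hqW : q ∈ W := by
      have : e.toFun 0 ∈ W ∩ S := hWV ▸ Set.mem_image_of_mem _ h0V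
      rw [e.map_zero] at this
      exact this.1
    filter_upwards [(c.continuousAt hF0.1).eventually (hW.mem_nhds (by rwa [hFq])),
      Metric.isOpen_ball.mem_nhds hF0.1] with x hxW hxb hxm
    have hx : c.toFun x ∈ W ∩ S := ⟨hxW, c.map_mem x hxb⟩
    rw [← hWV] at hx
    obtain ⟨z, hz, hzx⟩ := hx
    rw [← hzx, ← (hV z hz).1]
    exact haxis x hxb hxm z (hV z hz).2 hzx.symm
  have hcomp : HasDerivAt (fun w => G (c.toFun (F w)))
      (fderiv ℂ (fun x => G (c.toFun x)) (F 0) (deriv F 0)) 0 :=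
    HasFDerivAt.comp_hasDerivAt (f := F) 0 hψ.differentiableAt.hasFDerivAt hdiff.hasDerivAt
  have hid : HasDerivAt (fun w => G (c.toFun (F w))) 1 0 := by
    refine (hasDerivAt_id (0 : ℂ)).congr_of_eventuallyEq ?_
    have ht : Filter.Tendsto transversal (nhds 0) (nhds 0) := by
      have := (analyticAt_transversal 0).continuousAt
      rwa [ContinuousAt, transversal_zero] at this
    filter_upwards [ht.eventually hev, hlift] with w h1 h2
    rw [h2, ← h1, transversal_apply_one, id]
  have hone := hcomp.unique hid
  have hother : ∀ j, j ≠ m → ∀ s : ℂ,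
      fderiv ℂ (fun x => G (c.toFun x)) (F 0) (EuclideanSpace.single j s) = 0 := by
    intro j hj s
    have hline : HasDerivAt (fun t : ℂ => F 0 + t • (EuclideanSpace.single j s : C2))
        (EuclideanSpace.single j s) 0 := by
      simpa using ((hasDerivAt_id (0 : ℂ)).smul_const (EuclideanSpace.single j s : C2)).const_add
        (F 0)
    have hl0 : F 0 + (0 : ℂ) • (EuclideanSpace.single j s : C2) = F 0 := by simp
    have h1 : HasDerivAt (fun t : ℂ => G (c.toFun (F 0 + t • (EuclideanSpace.single j s : C2))))
        (fderiv ℂ (fun x => G (c.toFun x)) (F 0) (EuclideanSpace.single j s)) 0 := by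
      have hfd : HasFDerivAt (fun x => G (c.toFun x)) (fderiv ℂ (fun x => G (c.toFun x)) (F 0))
          (F 0 + (0 : ℂ) • (EuclideanSpace.single j s : C2)) := by
        rw [hl0]
        exact hψ.differentiableAt.hasFDerivAt
      exact HasFDerivAt.comp_hasDerivAt
        (f := fun t : ℂ => F 0 + t • (EuclideanSpace.single j s : C2)) 0 hfd hline
    refine h1.unique ((hasDerivAt_const (0 : ℂ) (0 : ℂ)).congr_of_eventuallyEq ?_)
    have ht := hline.continuousAt
    rw [ContinuousAt, hl0] at ht
    filter_upwards [ht.eventually hzero] with t h2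
    exact h2 (by simp [hm, hj.symm])
  intro hd
  have hdm : (deriv F 0) m = 0 := by
    have h1 := (EuclideanSpace.proj m : C2 →L[ℂ] ℂ).hasFDerivAt.comp_hasDerivAt (0 : ℂ)
      hdiff.hasDerivAt
    exact h1.deriv.symm.trans hd
  have hsum : deriv F 0 = ∑ j, EuclideanSpace.single j (deriv F 0 j) := by
    ext i
    fin_cases i <;> simp
  rw [hsum, map_sum, Finset.sum_eq_zero] at hone
  · exact zero_ne_one hone
  · intro j _
    by_cases hj : j = m
    · subst hj
      rw [hdm, show (EuclideanSpace.single j (0 : ℂ) : C2) = 0 by ext i; simp, _root_.map_zero]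
    · exact hother j hj _

end QuotientChart

/-! ### Lifting small loops around an axis. -/

namespace QuotientChart

variable {N : ℕ} {S : Set (CP N)} {p : CP N} (c : QuotientChart S p) {K : Finset (Fin 2)}

/-- The deck transformation that translates the `m`-th coordinate by `2πi`. -/
def deckTranslation {m : Fin 2} (hm : m ∈ K) : c.deckGroup K :=
  ⟨(1, Multiplicative.ofAdd (Pi.single m (2 * Real.pi * Complex.I))), c.A.one_mem, fun k _ j => by
    by_cases hk : k = m
    · subst hk
      simp [Matrix.one_apply, Complex.exp_two_pi_mul_I, eq_comm]
    · simp [Matrix.one_apply, hk, eq_comm], fun k hk => by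
    have : k ≠ m := fun h => hk (h ▸ hm)
    simp [this]⟩

/-- A loop that runs around the axis `{z_m = 0}` once, in a disc that is transversal to it. -/
theorem exists_lift_transversal_loop {R ε : ℝ} (hε : 0 < ε) (hεR : ε < R) {F : ℂ → C2}
    (hF : ContinuousOn F (Metric.ball 0 R)) (hmem : ∀ w ∈ Metric.ball (0 : ℂ) R, F w ∈ c.freeBall)
    {m : Fin 2} (hm : m ∈ K) (hm0 : F 0 m = 0)
    (hne : ∀ w ∈ Metric.ball (0 : ℂ) R, w ≠ 0 → F w m ≠ 0)
    (hother : ∀ j ∈ K, j ≠ m → ∀ w ∈ Metric.ball (0 : ℂ) R, F w j ≠ 0)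
    (hd : DifferentiableAt ℂ F 0) (hd0 : deriv (fun w => F w m) 0 ≠ 0) :
    ∃ L : unitInterval → c.cover K, Continuous L ∧ L 1 = c.deckTranslation hm • L 0 ∧
      ∀ t : unitInterval, expOn K (L t) =
        F (ε * Complex.exp (2 * Real.pi * Complex.I * ((t : ℝ) : ℂ))) := by
  have hR : 0 < R := hε.trans hεR
  have : ContractibleSpace (Metric.ball (0 : ℂ) R) := Metric.contractibleSpace_ball hR
  have : LocallyPathConnectedSpace (Metric.ball (0 : ℂ) R) :=
    Metric.isOpen_ball.locallyPathConnectedSpace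
  have hFj : ∀ j, ContinuousOn (fun w => F w j) (Metric.ball 0 R) := fun j =>
    (EuclideanSpace.proj j : C2 →L[ℂ] ℂ).continuous.comp_continuousOn hF
  obtain ⟨H, hH, hHexp⟩ := exists_eq_mul_exp hR (hFj m) hm0 hne
    (differentiableAt_piLp _ |>.1 hd m) hd0
  have hV : ∀ j, ∃ V : Metric.ball (0 : ℂ) R → ℂ, Continuous V ∧
      ∀ w, j ≠ m → (if j ∈ K then Complex.exp (V w) else V w) = F w j := by
    intro j
    by_cases hj : j ∈ K ∧ j ≠ m
    · obtain ⟨V, hVc, hV⟩ := exists_continuous_log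
        (continuousOn_iff_continuous_domRestrict.1 (hFj j)) fun w => hother j hj.1 hj.2 w w.2
      exact ⟨V, hVc, fun w _ => by rw [if_pos hj.1, hV, Set.domRestrict_apply]⟩
    · refine ⟨_, continuousOn_iff_continuous_domRestrict.1 (hFj j), fun w hjm => ?_⟩
      rw [if_neg fun h => hj ⟨h, hjm⟩, Set.domRestrict_apply]
  choose V hVc hV using hV
  let ω : unitInterval → Metric.ball (0 : ℂ) R := fun t =>
    ⟨ε * Complex.exp (2 * Real.pi * Complex.I * ((t : ℝ) : ℂ)), by
      rw [mem_ball_zero_iff, norm_mul, Complex.norm_real, Real.norm_of_nonneg hε.le,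
        show 2 * Real.pi * Complex.I * ((t : ℝ) : ℂ) = ((2 * Real.pi * t : ℝ) : ℂ) * Complex.I by
          push_cast; ring, Complex.norm_exp_ofReal_mul_I, mul_one]
      exact hεR⟩
  have hω : Continuous ω := by
    refine Continuous.subtype_mk ?_ _
    fun_prop
  have hω01 : ω 1 = ω 0 := by
    refine Subtype.ext ?_
    simp [ω, Complex.exp_two_pi_mul_I]
  -- Only the term `2πit` fails to be periodic: the other logarithms are defined on the whole disc
  -- and return to their values.
  let L₀ : unitInterval → Fin 2 → ℂ := fun t j =>
    if j = m then (Real.log ε : ℂ) + 2 * Real.pi * Complex.I * ((t : ℝ) : ℂ) + H (ω t)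
    else V j (ω t)
  have hexp : ∀ t, expOn K (L₀ t) = F (ω t) := by
    intro t
    ext j
    by_cases hj : j = m
    · subst hj
      rw [expOn_apply_mem hm, ← hHexp]
      simp only [L₀, if_true, Complex.exp_add, ← Complex.ofReal_exp, Real.exp_log hε, ω]
    · rw [← hV j _ hj]
      simp only [L₀, expOn, if_neg hj]
  have hLm : ∀ t, L₀ t ∈ c.cover K := fun t => by
    rw [cover, Set.mem_preimage, hexp]
    exact hmem _ (ω t).2
  refine ⟨fun t => ⟨L₀ t, hLm t⟩, Continuous.subtype_mk (continuous_pi fun j => ?_) hLm, ?_, hexp⟩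
  · by_cases hj : j = m
    · simp only [L₀, hj, if_true]
      fun_prop
    · simp only [L₀, hj, if_false]
      exact (hVc j).comp hω
  · refine Subtype.ext (funext fun j => ?_)
    by_cases hjK : j ∈ K
    · rw [c.deck_smul_apply_mem hjK]
      by_cases hj : j = m
      · subst hj
        simp only [L₀, if_true, hω01, deckTranslation]
        simp
        ring
      · simp [L₀, hj, hω01, deckTranslation]
    · have hj : j ≠ m := fun h => hjK (h ▸ hm)
      rw [c.deck_smul_apply_notMem hjK]
      have h1 : (c.deckTranslation hm).1.1 = 1 := rfl
      rw [h1, act_one, expOn_apply_notMem hjK]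
      simp [L₀, hj, hω01]

end QuotientChart

namespace Orbifold

variable {N : ℕ} {O : Orbifold N} {p : CP N} {c : QuotientChart O.X p} {k : Fin O.r → Fin 2}

namespace IsAdaptedBy

variable (h : O.IsAdaptedBy c k)
include h

theorem mem_of_isMeridian {i : Fin O.r}
    {x₀ : O.regularPart (c.toFun '' Metric.ball (0 : C2) c.radius)} {g : FundamentalGroup _ x₀}
    (hg : O.IsMeridian _ i x₀ g) : p ∈ O.D i := by
  obtain ⟨q, e, -, hU, hDi, -⟩ := hg
  obtain ⟨x, hx, hxe⟩ := hU ⟨0, e.zero_mem, rfl⟩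
  have h1 : e.toFun 0 ∈ O.D i := (hDi 0 e.zero_mem).2 rfl
  rw [← hxe, h.2 i x hx] at h1
  exact h1.1

theorem fundamentalGroupToMulOpposite_of_isMeridian {i : Fin O.r}
    {x₀ : O.regularPart (c.toFun '' Metric.ball (0 : C2) c.radius)} {g : FundamentalGroup _ x₀}
    (hg : O.IsMeridian _ i x₀ g) (hi : k i ∈ O.axes p k)
    (e₀ : c.coverMap h.regularPart_eq ⁻¹' {x₀}) :
    h.isQuotientCoveringMap.fundamentalGroupToMulOpposite e₀ g =
      MulOpposite.op (c.deckTranslation hi) := by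
  have hpi := h.mem_of_isMeridian hg
  obtain ⟨q, e, heA, hU, hDi, hDj, ε, hε, hεr, y, γ, l, hl, rfl⟩ := hg
  change ∀ t : unitInterval, ((l t).1 : CP N) = e.toFun (transversal _) at hl
  have hq : e.toFun 0 = q := e.map_zero
  have hlift : ∀ w ∈ Metric.ball (0 : ℂ) e.radius,
      e.toFun (transversal w) ∈ c.toFun '' c.freeBall := by
    intro w hw
    have hw' := transversal_mem_ball.2 hw
    obtain ⟨x, hx, hxe⟩ := hU ⟨_, hw', rfl⟩
    rw [← hxe]
    -- The disc can meet `p` only at its centre, since `p` lies on the component. Then `p` itself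
    -- has a smooth chart and `A` is trivial.
    refine c.mem_image_freeBall hx fun hA hxp => hA ?_
    have h1 : w = 0 := by
      rw [← transversal_apply_one w, ← hDi _ hw', ← hxe, hxp]
      exact hpi
    have hqp : q = p := by
      rw [← hxp, hxe, h1, transversal_zero, hq]
    subst hqp
    exact c.eq_bot_of_eq_bot e heA
  obtain ⟨F, hF, hFl⟩ := c.exists_lift_transversal e hlift
  have h0 : (0 : ℂ) ∈ Metric.ball (0 : ℂ) e.radius := Metric.mem_ball_self e.radius_pos
  have hnhds := Metric.ball_mem_nhds (0 : ℂ) e.radius_pos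
  have hev : ∀ᶠ w in nhds 0, c.toFun (F w) = e.toFun (transversal w) := by
    filter_upwards [hnhds] with w hw using (hFl w hw).2
  have hF0 := hF.continuousAt hnhds
  have hFi : ∀ w ∈ Metric.ball (0 : ℂ) e.radius, F w (k i) = 0 ↔ w = 0 := by
    intro w hw
    have h1 := hDi _ (transversal_mem_ball.2 hw)
    rw [transversal_apply_one, ← (hFl w hw).2, h.2 i _ (hFl w hw).1.1] at h1
    rw [← h1]
    exact ⟨fun h2 => ⟨hpi, h2⟩, fun h2 => h2.2⟩
  have hother : ∀ j ∈ O.axes p k, j ≠ k i → ∀ w ∈ Metric.ball (0 : ℂ) e.radius, F w j ≠ 0 := by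
    intro j hj hjk w hw hFj
    obtain ⟨i', hi', rfl⟩ := mem_axes.1 hj
    refine hDj i' (fun hii => hjk (by rw [hii])) _ (transversal_mem_ball.2 hw) ?_
    rw [← (hFl w hw).2, h.2 i' _ (hFl w hw).1.1]
    exact ⟨hi', hFj⟩
  obtain ⟨L, hL, hL1, hLF⟩ := c.exists_lift_transversal_loop hε hεr hF (fun w hw => (hFl w hw).1)
    hi ((hFi 0 h0).2 rfl) (fun w hw hw0 hF' => hw0 ((hFi w hw).1 hF')) hother
    (QuotientChart.differentiableAt_lift_transversal hF0 (hFl 0 h0).1 hev)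
    (QuotientChart.deriv_lift_transversal_ne_zero heA hF0 (hFl 0 h0).1 hev ((hFi 0 h0).2 rfl)
      fun x hx hxk z hz hxz => by
        rw [← hDi z hz, ← hxz, h.2 i x hx]
        exact ⟨hpi, hxk⟩)
  refine fundamentalGroupToMulOpposite_conj h.isQuotientCoveringMap c.deckGroup_mul_comm
    e₀ γ l hL (fun t => Subtype.ext ?_) hL1
  rw [hl]
  change c.toFun (expOn _ (L t)) = _
  rw [hLF]
  refine (hFl _ ?_).2
  rw [mem_ball_zero_iff, norm_mul, Complex.norm_real, Real.norm_of_nonneg hε.le,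
    show 2 * Real.pi * Complex.I * ((t : ℝ) : ℂ) = ((2 * Real.pi * t : ℝ) : ℂ) * Complex.I by
      push_cast; ring, Complex.norm_exp_ofReal_mul_I, mul_one]
  exact hεr

end IsAdaptedBy

end Orbifold

/-! ### Existence of meridians. -/

namespace Orbifold.IsAdaptedBy

variable {N : ℕ} {O : Orbifold N} {p : CP N} {c : QuotientChart O.X p} {k : Fin O.r → Fin 2}
variable (h : O.IsAdaptedBy c k)
include h

theorem pathConnectedSpace_regularPart :
    PathConnectedSpace (O.regularPart (c.toFun '' Metric.ball (0 : C2) c.radius)) := by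
  have := (c.isSimplyConnected_cover (O.axes p k)).simplyConnectedSpace
  exact h.isQuotientCoveringMap.surjective.pathConnectedSpace h.isQuotientCoveringMap.continuous

theorem exists_isMeridian {i : Fin O.r} (hi : p ∈ O.D i)
    (x₀ : O.regularPart (c.toFun '' Metric.ball (0 : C2) c.radius)) :
    ∃ g, O.IsMeridian (c.toFun '' Metric.ball (0 : C2) c.radius) i x₀ g := by
  have := h.pathConnectedSpace_regularPart
  have hr := c.radius_pos
  set σ : Equiv.Perm (Fin 2) := Equiv.swap 1 (k i) with hσ
  let L : C2 ≃ₗᵢ[ℂ] C2 := LinearIsometryEquiv.piLpCongrLeft 2 ℂ ℂ σ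
  have hL : ∀ w m, L w m = w (σ m) := fun w m => by
    simp [L, LinearIsometryEquiv.piLpCongrLeft_apply, Equiv.piCongrLeft', hσ]
  have hLi : ∀ w, L w (k i) = w 1 := fun w => by rw [hL, hσ, Equiv.swap_apply_right]
  have hσi : ∀ m, m ≠ k i → σ m = 0 := fun m hm => by
    have h1 : σ m ≠ 1 := fun h1 => hm (by
      rw [hσ, Equiv.swap_apply_eq_iff, Equiv.swap_apply_left] at h1
      exact h1)
    revert h1
    generalize σ m = n
    fin_cases n <;> simp
  -- A point on the axis of the component at distance `c.radius / 2` from the origin. A chart around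
  -- it of radius at most this distance avoids the other axis.
  let x : C2 := L (EuclideanSpace.single 0 ((c.radius / 2 : ℝ) : ℂ))
  have hxi : x (k i) = 0 := by rw [hLi]; simp
  have hxm : ∀ m, m ≠ k i → x m = ((c.radius / 2 : ℝ) : ℂ) := fun m hm => by
    rw [hL, hσi m hm]; simp
  have hxn : ‖x‖ = c.radius / 2 := by
    rw [L.norm_map, PiLp.norm_single, Complex.norm_real, Real.norm_of_nonneg (by positivity)]
  have hxb : x ∈ Metric.ball (0 : C2) c.radius := by
    rw [mem_ball_zero_iff, hxn]; linarith
  have hx0 : x ≠ 0 := by rw [← norm_pos_iff, hxn]; positivity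
  obtain ⟨e, heA, heη, hesub, he⟩ := c.exists_chart_translate hxb (fun _ => hx0) L
    (η := c.radius / 2) (by positivity)
  have hmem : ∀ w ∈ Metric.ball (0 : C2) e.radius, x + L w ∈ Metric.ball (0 : C2) c.radius := by
    intro w hw
    rw [mem_ball_zero_iff] at hw
    exact hesub (by simpa [Metric.mem_ball, dist_eq_norm] using hw)
  have hadd : ∀ w m, (x + L w) m = x m + L w m := fun w m => rfl
  have hother : ∀ w ∈ Metric.ball (0 : C2) e.radius, ∀ m, m ≠ k i → (x + L w) m ≠ 0 := by
    intro w hw m hm h0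
    rw [hadd, hxm m hm] at h0
    have h1 : ‖L w m‖ = c.radius / 2 := by
      rw [eq_neg_of_add_eq_zero_right h0, norm_neg, Complex.norm_real,
        Real.norm_of_nonneg (by positivity)]
    have h2 := PiLp.norm_apply_le (L w) m
    rw [h1, L.norm_map] at h2
    rw [mem_ball_zero_iff] at hw
    linarith
  have haxis : ∀ w, (x + L w) (k i) = w 1 := fun w => by rw [hadd, hxi, hLi, zero_add]
  have her := e.radius_pos
  have hε : e.radius / 2 < e.radius := by linarith
  let ω : unitInterval → ℂ := fun t =>
    ((e.radius / 2 : ℝ) : ℂ) * Complex.exp (2 * Real.pi * Complex.I * ((t : ℝ) : ℂ))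
  have hω : Continuous ω := by fun_prop
  have hωn : ∀ t, ‖ω t‖ = e.radius / 2 := fun t => by
    rw [norm_mul, Complex.norm_real, Real.norm_of_nonneg (by positivity),
      show 2 * Real.pi * Complex.I * ((t : ℝ) : ℂ) = ((2 * Real.pi * t : ℝ) : ℂ) * Complex.I by
        push_cast; ring, Complex.norm_exp_ofReal_mul_I, mul_one]
  have hωmem : ∀ t, transversal (ω t) ∈ Metric.ball (0 : C2) e.radius := fun t => by
    rw [mem_ball_zero_iff, norm_transversal, hωn]
    exact hε
  have hreg : ∀ t, e.toFun (transversal (ω t)) ∈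
      O.regularPart (c.toFun '' Metric.ball (0 : C2) c.radius) := fun t => by
    have hne : ∀ m, (x + L (transversal (ω t))) m ≠ 0 := fun m => by
      by_cases hm : m = k i
      · rw [hm, haxis, transversal_apply_one, ← norm_pos_iff, hωn]
        positivity
      · exact hother _ (hωmem t) m hm
    rw [h.regularPart_eq, he]
    exact ⟨_, ⟨⟨hmem _ (hωmem t), fun _ h0 => hne 0 (by rw [h0]; rfl)⟩, fun m _ => hne m⟩, rfl⟩
  let ℓ : unitInterval → O.regularPart (c.toFun '' Metric.ball (0 : C2) c.radius) :=
    fun t => ⟨e.toFun (transversal (ω t)), hreg t⟩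
  have hℓ : Continuous ℓ := by
    refine Continuous.subtype_mk (continuous_iff_continuousAt.2 fun t => ?_) _
    refine ContinuousAt.comp (f := fun t => transversal (ω t)) (e.continuousAt (hωmem t)) ?_
    exact ContinuousAt.comp (f := ω) (analyticAt_transversal _).continuousAt hω.continuousAt
  have hℓ1 : ℓ 1 = ℓ 0 := by
    refine Subtype.ext ?_
    simp [ℓ, ω, Complex.exp_two_pi_mul_I]
  refine ⟨_, c.toFun x, e, heA, ?_, fun z hz => ?_, fun j hj z hz => ?_, e.radius / 2,
    by positivity, hε, ℓ 0, PathConnectedSpace.somePath _ _, ⟨⟨ℓ, hℓ⟩, rfl, hℓ1⟩, fun t => rfl, rfl⟩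
  · rintro _ ⟨w, hw, rfl⟩
    rw [he]
    exact ⟨_, hmem w hw, rfl⟩
  · rw [he]
    simp only
    rw [h.2 i _ (hmem z hz), haxis]
    exact and_iff_right hi
  · rw [he]
    simp only
    rw [h.2 j _ (hmem z hz)]
    rintro ⟨hpj, h0⟩
    exact hother z hz (k j) (fun hk => hj (h.1 hpj hi hk)) h0

end Orbifold.IsAdaptedBy

/-! ### The index of a lattice of deck transformations -/

namespace QuotientChart

variable {N : ℕ} {S : Set (CP N)} {p : CP N} (c : QuotientChart S p) {K : Finset (Fin 2)}

instance : CommGroup (c.deckGroup K) where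
  mul_comm := c.deckGroup_mul_comm

variable (K) in
/-- The projection of the group of deck transformations to `A`. -/
def deckProj : c.deckGroup K →* c.A where
  toFun g := ⟨g.1.1, g.2.1⟩
  map_one' := rfl
  map_mul' _ _ := rfl

theorem deckProj_eq_one {g : c.deckGroup K} : c.deckProj K g = 1 ↔ g.1.1 = 1 :=
  Subtype.ext_iff

/-- Invertibility and preservation of the axes make the diagonal entries in `K` nonzero, and any
choice of their logarithms gives a lift. -/
theorem deckProj_surjective (hK : c.PreservesAxes K) : Function.Surjective (c.deckProj K) := by
  rintro ⟨a, ha⟩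
  have hne : ∀ m ∈ K, (a : Matrix (Fin 2) (Fin 2) ℂ) m m ≠ 0 := by
    intro m hm h0
    have h1 : act a (act a⁻¹ (EuclideanSpace.single m 1)) m = 0 := by
      rw [act_apply]
      refine Finset.sum_eq_zero fun j _ => ?_
      by_cases hj : j = m
      · rw [hj, h0, zero_mul]
      · rw [hK a ha m hm j hj, zero_mul]
    rw [act_act_inv] at h1
    simp at h1
  refine ⟨⟨(a, Multiplicative.ofAdd fun m => if m ∈ K then
    Complex.log ((a : Matrix (Fin 2) (Fin 2) ℂ) m m) else 0), ha, fun m hm j => ?_,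
    fun m hm => by simp [hm]⟩, rfl⟩
  by_cases hj : j = m
  · subst hj
    simp [hm, Complex.exp_log (hne j hm)]
  · rw [if_neg hj]
    exact hK a ha m hm j hj

theorem exp_eq_one_of_mem_ker {g : c.deckGroup K} (hg : g ∈ (c.deckProj K).ker) (m : Fin 2) :
    Complex.exp (g.1.2.toAdd m) = 1 := by
  by_cases hm : m ∈ K
  · have h1 := g.2.2.1 m hm m
    rw [if_pos rfl, c.deckProj_eq_one.1 hg] at h1
    rw [← h1]
    simp
  · rw [g.2.2.2 m hm, Complex.exp_zero]

theorem deckTranslation_mem_ker {m : Fin 2} (hm : m ∈ K) :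
    c.deckTranslation hm ∈ (c.deckProj K).ker := c.deckProj_eq_one.2 rfl

variable (K) in
/-- The homomorphism from the group of translations to products of roots of unity. -/
def deckRoots (n : Fin 2 → ℕ) (hn : ∀ m, n m ≠ 0) :
    (c.deckProj K).ker →* ((m : Fin 2) → rootsOfUnity (n m) ℂ) where
  toFun g m := ⟨Units.mk0 (Complex.exp (g.1.1.2.toAdd m / n m)) (Complex.exp_ne_zero _), by
    rw [mem_rootsOfUnity', Units.val_mk0, ← Complex.exp_nat_mul,
      mul_div_cancel₀ _ (Nat.cast_ne_zero.2 (hn m)), c.exp_eq_one_of_mem_ker g.2]⟩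
  map_one' := by
    ext m
    simp
  map_mul' g h := by
    ext m
    simp [add_div, Complex.exp_add]

theorem deckRoots_apply {n : Fin 2 → ℕ} {hn : ∀ m, n m ≠ 0} (g : (c.deckProj K).ker) (m : Fin 2) :
    ((c.deckRoots K n hn g m : ℂˣ) : ℂ) = Complex.exp (g.1.1.2.toAdd m / n m) := rfl

theorem deckRoots_surjective {n : Fin 2 → ℕ} {hn : ∀ m, n m ≠ 0} (hnK : ∀ m ∉ K, n m = 1) :
    Function.Surjective (c.deckRoots K n hn) := by
  intro ζ
  have hζ : ∀ m, ((ζ m : ℂˣ) : ℂ) ^ n m = 1 := fun m => (mem_rootsOfUnity' _ _).1 (ζ m).2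
  let t : Fin 2 → ℂ := fun m => if m ∈ K then n m * Complex.log ((ζ m : ℂˣ) : ℂ) else 0
  have ht : ∀ m ∈ K, Complex.exp (t m) = 1 := fun m hm => by
    simp only [t, hm, if_true]
    rw [Complex.exp_nat_mul, Complex.exp_log (Units.ne_zero _), hζ]
  let g : c.deckGroup K := ⟨(1, Multiplicative.ofAdd t), c.A.one_mem, fun m hm j => by
    simp [ht m hm, Matrix.one_apply, eq_comm], fun m hm => by simp [t, hm]⟩
  refine ⟨⟨g, c.deckProj_eq_one.2 rfl⟩, funext fun m => Subtype.ext (Units.ext ?_)⟩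
  rw [c.deckRoots_apply]
  change Complex.exp (t m / n m) = _
  by_cases hm : m ∈ K
  · simp only [t, hm, if_true]
    rw [mul_div_cancel_left₀ _ (Nat.cast_ne_zero.2 (hn m)), Complex.exp_log (Units.ne_zero _)]
  · have h1 : ∀ z : ℂ, z ^ n m = 1 → z = 1 := fun z hz => by rwa [hnK m hm, pow_one] at hz
    simp [t, hm, h1 _ (hζ m)]

theorem mem_ker_deckRoots {n : Fin 2 → ℕ} {hn : ∀ m, n m ≠ 0} {g : (c.deckProj K).ker} :
    g ∈ (c.deckRoots K n hn).ker ↔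
      ∀ m, ∃ z : ℤ, g.1.1.2.toAdd m = n m * (z * (2 * Real.pi * Complex.I)) := by
  rw [MonoidHom.mem_ker, funext_iff]
  refine forall_congr' fun m => ?_
  rw [Subtype.ext_iff, Units.ext_iff, c.deckRoots_apply]
  change Complex.exp _ = 1 ↔ _
  rw [Complex.exp_eq_one_iff]
  refine exists_congr fun z => ?_
  rw [div_eq_iff (Nat.cast_ne_zero.2 (hn m)), mul_comm]

/-- The index of the subgroup generated by the `n_m`-fold multiples of the translations by
`2πi`. -/
theorem index_of_lattice (hK : c.PreservesAxes K) {n : Fin 2 → ℕ} (hn : ∀ m, n m ≠ 0)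
    (hnK : ∀ m ∉ K, n m = 1) {Λ : Subgroup (c.deckGroup K)}
    (hle : Λ ≤ (c.deckRoots K n hn).ker.map (c.deckProj K).ker.subtype)
    (hmem : ∀ m (hm : m ∈ K), c.deckTranslation hm ^ n m ∈ Λ) :
    Λ.index = (∏ m, n m) * Nat.card c.A := by
  -- An element of the kernel is the product over the two coordinates of integer powers of the
  -- generators assumed to lie in `Λ`.
  have hΛ : Λ = (c.deckRoots K n hn).ker.map (c.deckProj K).ker.subtype := by
    refine hle.antisymm ?_
    rintro _ ⟨g, hg, rfl⟩
    choose z hz using c.mem_ker_deckRoots.1 hg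
    let y : Fin 2 → c.deckGroup K := fun m =>
      if hm : m ∈ K then (c.deckTranslation hm ^ n m) ^ z m else 1
    have hy : ∀ m, y m ∈ Λ := fun m => by
      by_cases hm : m ∈ K
      · simp only [y, dif_pos hm]
        exact Λ.zpow_mem (hmem m hm) _
      · simp only [y, dif_neg hm]
        exact Λ.one_mem
    have hy1 : ∀ m, (y m).1.1 = 1 := fun m => by
      by_cases hm : m ∈ K <;> simp [y, hm, deckTranslation]
    have hy2 : ∀ m, (y m).1.2.toAdd = Pi.single m (g.1.1.2.toAdd m) := fun m => by
      by_cases hm : m ∈ K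
      · ext j
        by_cases hj : j = m
        · subst hj
          simp [y, hm, deckTranslation, hz]
          ring
        · simp [y, hm, deckTranslation, hj]
      · simp [y, hm, g.1.2.2.2 m hm]
    have hg' : g.1 = y 0 * y 1 := by
      refine Subtype.ext (Prod.ext ?_ ?_)
      · change g.1.1.1 = (y 0).1.1 * (y 1).1.1
        rw [hy1, hy1, c.deckProj_eq_one.1 g.2, mul_one]
      · change g.1.1.2.toAdd = (y 0).1.2.toAdd + (y 1).1.2.toAdd
        rw [hy2, hy2]
        ext j
        fin_cases j <;> simp
    rw [Subgroup.subtype_apply, hg']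
    exact Λ.mul_mem (hy 0) (hy 1)
  have hker : Λ ≤ (c.deckProj K).ker := by
    rw [hΛ]
    exact Subgroup.map_subtype_le _
  have hsub : Λ.subgroupOf (c.deckProj K).ker = (c.deckRoots K n hn).ker := by
    rw [hΛ, Subgroup.subgroupOf]
    exact Subgroup.comap_map_eq_self_of_injective (Subgroup.subtype_injective _) _
  -- The index splits through the translation lattice: the roots of unity give `∏ n m`, and the
  -- quotient by all translations gives `A`.
  rw [← Subgroup.relIndex_mul_index hker, Subgroup.relIndex, hsub, Subgroup.index_ker,
    Subgroup.index_ker, MonoidHom.range_eq_top.2 (c.deckRoots_surjective hnK),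
    MonoidHom.range_eq_top.2 (c.deckProj_surjective hK), Subgroup.card_top, Subgroup.card_top,
    Nat.card_pi]
  congr 1
  refine Finset.prod_congr rfl fun m _ => ?_
  have : NeZero (n m) := ⟨hn m⟩
  exact Complex.card_rootsOfUnity (n m)

end QuotientChart

/-! ### The order of the local orbifold fundamental group -/

namespace Orbifold

variable {N : ℕ} {O : Orbifold N} {p : CP N} {c : QuotientChart O.X p} {k : Fin O.r → Fin 2}

open Classical in
/-- The product of the `n_i` of the components through `p` that lie under the `m`-th axis. -/
def axisIndex (O : Orbifold N) (p : CP N) (k : Fin O.r → Fin 2) (m : Fin 2) : ℕ :=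
  ∏ i ∈ (Finset.univ.filter fun i => p ∈ O.D i).filter fun i => k i = m, O.φ i

theorem prod_axisIndex_mul_quotientOrder :
    (∏ m, O.axisIndex p k m) * quotientOrder O.X p = O.orbifoldIndex p := by
  classical
  rw [orbifoldIndex]
  congr 1
  exact Finset.prod_fiberwise _ _ _

theorem axisIndex_ne_zero (hp : p ∈ O.positivePart) (m : Fin 2) : O.axisIndex p k m ≠ 0 := by
  classical
  refine Finset.prod_ne_zero_iff.2 fun i hi h0 => hp.2 ?_
  simp only [Finset.mem_filter, Finset.mem_univ, true_and] at hi
  exact Set.mem_biUnion (x := i) h0 hi.1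

theorem axisIndex_of_notMem {m : Fin 2} (hm : m ∉ O.axes p k) : O.axisIndex p k m = 1 := by
  classical
  refine Finset.prod_eq_one fun i hi => (hm ?_).elim
  simp only [Finset.mem_filter, Finset.mem_univ, true_and] at hi
  exact mem_axes.2 ⟨i, hi.1, hi.2⟩

namespace IsAdaptedBy

variable (h : O.IsAdaptedBy c k)
include h

theorem axisIndex_eq {i : Fin O.r} (hi : p ∈ O.D i) : O.axisIndex p k (k i) = O.φ i := by
  classical
  have : ((Finset.univ.filter fun i => p ∈ O.D i).filter fun j => k j = k i) = {i} := by
    ext j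
    simp only [Finset.mem_filter, Finset.mem_univ, true_and, Finset.mem_singleton]
    exact ⟨fun hj => h.1 hj.1 hi hj.2, fun hj => by subst hj; exact ⟨hi, rfl⟩⟩
  rw [axisIndex, this, Finset.prod_singleton]

/-- Only components through `p` have meridians in the ball, and all meridians of one component have
the same image in the abelian deck group. Thus the normal closure becomes the lattice generated by
the multiples of the basic translations. -/
theorem index_meridianSubgroup (hp : p ∈ O.positivePart)
    (x₀ : O.regularPart (c.toFun '' Metric.ball (0 : C2) c.radius)) :
    (O.meridianSubgroup _ x₀).index = O.orbifoldIndex p := by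
  have hs := (c.isSimplyConnected_cover (O.axes p k)).simplyConnectedSpace
  obtain ⟨u, hu⟩ := h.isQuotientCoveringMap.surjective x₀
  let e₀ : c.coverMap h.regularPart_eq ⁻¹' {x₀} := ⟨u, hu⟩
  let Φ : FundamentalGroup _ x₀ ≃* c.deckGroup (O.axes p k) :=
    (h.isQuotientCoveringMap.fundamentalGroupEquiv e₀).trans MulOpposite.opMulEquiv.symm
  have hΦ : ∀ {i : Fin O.r} {g : FundamentalGroup _ x₀}, O.IsMeridian _ i x₀ g →
      ∀ hi : k i ∈ O.axes p k, Φ g = c.deckTranslation hi := fun hg hi =>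
    congrArg MulOpposite.unop (h.fundamentalGroupToMulOpposite_of_isMeridian hg hi e₀)
  rw [← Subgroup.index_map_equiv _ Φ, c.index_of_lattice h.preservesAxes
    (n := O.axisIndex p k) (axisIndex_ne_zero hp) (fun m hm => axisIndex_of_notMem hm),
    ← c.quotientOrder_eq, prod_axisIndex_mul_quotientOrder]
  · rw [Subgroup.map_le_iff_le_comap]
    refine Subgroup.normalClosure_le_normal ?_
    rintro _ ⟨i, μ, hμ, rfl⟩
    have hpi := h.mem_of_isMeridian hμ
    have hi : k i ∈ O.axes p k := mem_axes.2 ⟨i, hpi, rfl⟩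
    have h1 : Φ (μ ^ O.φ i) = c.deckTranslation hi ^ O.φ i := by rw [map_pow, hΦ hμ hi]
    change Φ (μ ^ O.φ i) ∈ Subgroup.map _ _
    rw [h1]
    refine ⟨⟨_, pow_mem (c.deckTranslation_mem_ker hi) _⟩, c.mem_ker_deckRoots.2 fun m => ?_, rfl⟩
    by_cases hm : m = k i
    · subst hm
      refine ⟨1, ?_⟩
      rw [h.axisIndex_eq hpi]
      simp [QuotientChart.deckTranslation]
    · refine ⟨0, ?_⟩
      simp [QuotientChart.deckTranslation, hm]
  · intro m hm
    obtain ⟨i, hpi, rfl⟩ := mem_axes.1 hm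
    obtain ⟨μ, hμ⟩ := h.exists_isMeridian hpi x₀
    refine ⟨μ ^ O.φ i, Subgroup.subset_normalClosure ⟨i, μ, hμ, rfl⟩, ?_⟩
    rw [h.axisIndex_eq hpi, ← hΦ hμ hm]
    exact map_pow Φ μ _

theorem restrict {ρ : ℝ} (hρ : 0 < ρ) (hle : ρ ≤ c.radius) :
    O.IsAdaptedBy (c.restrict ρ hρ hle) k :=
  ⟨h.1, fun i z hz => h.2 i z (Metric.ball_subset_ball hle hz)⟩

end IsAdaptedBy

theorem orbifoldIndex_ne_zero (hp : p ∈ O.positivePart) : O.orbifoldIndex p ≠ 0 := by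
  classical
  refine mul_ne_zero (Finset.prod_ne_zero_iff.2 fun i hi h0 => hp.2 ?_) ?_
  · exact Set.mem_biUnion (x := i) h0 (Finset.mem_filter.1 hi).2
  · obtain ⟨c⟩ := O.quotient_singularities p hp.1
    have := c.finite_A
    rw [c.quotientOrder_eq]
    exact Nat.card_pos.ne'

end Orbifold

end OrbifoldSurface

end

theorem mainTheorem9 {N : ℕ} (O : OrbifoldSurface.Orbifold N) (hO : O.IsNormalCrossing)
    (p : OrbifoldSurface.CP N) (hp : p ∈ O.positivePart)
    (U : Set (OrbifoldSurface.CP N)) (hU : O.IsSmallBall p U) (x₀ : O.regularPart U) :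
    Finite (O.LocalOrbifoldGroup U x₀) ∧
      Nat.card (O.LocalOrbifoldGroup U x₀) = O.orbifoldIndex p := by
  obtain ⟨c, ⟨k, hk⟩, ρ, hρ, hle, rfl⟩ := hU
  have hadapted : O.IsAdaptedBy c k := hk
  have hcard : Nat.card (O.LocalOrbifoldGroup _ x₀) = O.orbifoldIndex p :=
    (hadapted.restrict hρ hle).index_meridianSubgroup hp x₀
  -- `Nat.card` is zero on infinite types, so finiteness follows from the index being nonzero, which
  -- holds on the positive part.
  exact ⟨Nat.finite_of_card_ne_zero (hcard ▸ O.orbifoldIndex_ne_zero hp), hcard⟩
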